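/- Let $\mathcal D(\mathbb R)$ be the space of complex-valued smooth functions on $\mathbb R$ with compact support and $\mathcal D'(\mathbb R)$ the space of distributions. *The Colombeau algebra.* For $q\in\mathbb N_0$ let $A_q$ be the set of $\varphi\in\mathcal D(\mathbb R)$ with $\int x^j\varphi(x)\,dx=\delta_{0j}$ for $0\le j\le q$; put $\varphi_\varepsilon(x)=\varepsilon^{-1}\varphi(\varepsilon^{-1}x)$ for $\varepsilon>0$ and $s(\varphi)=\sup\{|x|:\varphi(x)\neq0\}$. A function $F:A_0\times\mathbb R\to\mathbb C$, smooth in $x$, is *moderate* if for every compact $K$ and $p\in\mathbb N_0$ there is $q$ such that $\sup_{x\in K}|\partial_x^pF(\varphi_\varepsilon,x)|=O(\varepsilon^{-q})$ as $\varepsilon\to0_+$ for all $\varphi\in A_q$, and *null* if it is moderate and for every compact $K$ and $p$ there is $q$ such that this supremum is $O(\varepsilon^{r-q})$ for all $r\ge q$ and $\varphi\in A_r$. The Colombeau algebra $\mathcal G(\mathbb R)$ is the quotient of the algebra of moderate functions by the ideal of null functions. One writes $F\approx u$ (association), for $F\in\mathcal G(\mathbb R)$ and $u\in\mathcal D'(\mathbb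 R)$, if for some representative and every $\psi\in\mathcal D(\mathbb R)$ there is $q$ with $\lim_{\varepsilon\to0_+}\int F(\varphi_\varepsilon,x)\psi(x)\,dx=\langle u,\psi\rangle$ for all $\varphi\in A_q$. *The distributions.* $\theta$ is the Heaviside function, $\delta$ the Dirac distribution at $0$; $\ln x_+$ equals $\ln x$ for $x>0$ and $0$ for $x<0$; $\ln x_-$ equals $\ln(-x)$ for $x<0$ and $0$ for $x>0$; $\ln|x|\,\mathrm{sgn}\,x=\ln x_+-\ln x_-$. With distributional derivatives, $$x_+^{-2}=-\partial^2\ln x_+-\delta',\qquad x_-^{-2}=-\partial^2\ln x_-+\delta',\qquad x^{-2}\,\mathrm{sgn}\,x=x_+^{-2}-x_-^{-2}.$$ *The models.* Let $D(s,\cdot)\in\mathcal D(\mathbb R)$, $s>0$, be even with $\int D(s,x)\,dx=\frac1s\int D(s,x)^2\,dx=1$, and suppose that for small $s$ the supports lie in one interval $[-l,l]$ and, for each $k$, the functions $\partial_x^kD(s,\cdot)$ are bounded uniformly in $s$. (For example $D(s,x)=f(x)+\lambda_s\,g(x)$ with real-valued even $f,g\in\mathcal D(\mathbb R)$ of disjoint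 supports, $g\ne0$, $\int f=1$, $\int g=0$ and $\lambda_s\in\mathbb C$, $\lambda_s^2=(s-\int f^2)/\int g^2$.) Put $D_\sigma(x)=\sigma^{-1}D(\sigma,x/\sigma)$. The model in $\mathcal G(\mathbb R)$ of $u\in\mathcal D'(\mathbb R)$ is the class of $(\varphi,x)\mapsto(u*D_{s(\varphi)})(x)$. Let $X_+^{-2}$, $X^{-2}\,\mathrm{sgn}\,x$, $H$, $D'$, $\mathrm{Ln}\,x_-$ and $\mathrm{Ln}|x|\,\mathrm{sgn}\,x$ be the models of $x_+^{-2}$, $x^{-2}\,\mathrm{sgn}\,x$, $\theta$, $\delta'$, $\ln x_-$ and $\ln|x|\,\mathrm{sgn}\,x$. **Statement.** In $\mathcal G(\mathbb R)$, $$X^{-2}\,\mathrm{sgn}\,x\cdot H+\mathrm{Ln}|x|\,\mathrm{sgn}\,x\cdot D'\ \approx\ x_+^{-2}+2\delta$$ and $$X_+^{-2}\cdot H-\mathrm{Ln}\,x_-\cdot D'\ \approx\ x_+^{-2}+\delta.$$ -/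

import Mathlib

noncomputable section

namespace Colombeau

open Set Filter Topology MeasureTheory TopologicalSpace
open scoped Distributions ContDiff

/-! ### Test functions and distributions on the real line -/

/-- The space `𝓓(ℝ)` of complex-valued smooth functions with compact support. -/
abbrev Test : Type := 𝓓((⊤ : Opens ℝ), ℂ)

/-- The space `𝓓'(ℝ)` of distributions: continuous `ℂ`-linear forms on `𝓓(ℝ)`. -/
abbrev Distr : Type := Test →L[ℂ] ℂ

/-- The derivative of a test function, as a test function. -/
abbrev dTest : Test →L[ℂ] Test := TestFunction.lineDerivCLM ℂ (1 : ℝ)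

/-- The distributional derivative, `⟨∂u, ψ⟩ = -⟨u, ψ'⟩`. -/
def pd (u : Distr) : Distr := -(u ∘L dTest)

/-- The regular distribution `ψ ↦ ∫ f ψ` of a locally integrable function `f`. -/
def ofFun (f : ℝ → ℂ) : Distr :=
  TestFunction.integralAgainstBilinCLM (ContinuousLinearMap.mul ℂ ℂ) volume f

/-- The Dirac distribution `δ` at the origin. -/
def delta : Distr :=
  TestFunction.mkCLM ℂ (fun ψ : Test => ψ 0) (fun _ _ => rfl) (fun _ _ => rfl)
    (fun _ _ => (continuous_eval_const (0 : ℝ)).comp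
      (TestFunction.continuous_ofSupportedIn (by assumption)))

/-- The Heaviside function: `1` for `x > 0` and `0` for `x < 0`. -/
def thetaFun (x : ℝ) : ℂ := if 0 < x then 1 else 0

/-- `ln x₊`: equal to `ln x` for `x > 0` and to `0` for `x < 0`. -/
def lnPlusFun (x : ℝ) : ℂ := if 0 < x then (Real.log x : ℂ) else 0

/-- `ln x₋`: equal to `ln (-x)` for `x < 0` and to `0` for `x > 0`. -/
def lnMinusFun (x : ℝ) : ℂ := if x < 0 then (Real.log (-x) : ℂ) else 0

theorem locallyIntegrable_thetaFun : LocallyIntegrable thetaFun := by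
  have h : LocallyIntegrable (fun _ : ℝ => (1 : ℂ)) := locallyIntegrable_const _
  have := h.indicator (s := Ioi (0 : ℝ)) measurableSet_Ioi
  refine this.congr (Eventually.of_forall fun x => ?_)
  simp [thetaFun, indicator]

theorem locallyIntegrable_log : LocallyIntegrable (fun x : ℝ => (Real.log x : ℂ)) := by
  intro x
  have h : IntervalIntegrable Real.log volume (x - 1) (x + 1) :=
    intervalIntegral.intervalIntegrable_log'
  rw [intervalIntegrable_iff_integrableOn_Ioc_of_le (by linarith)] at h
  exact ⟨Ioc (x - 1) (x + 1), Ioc_mem_nhds (by linarith) (by linarith), h.ofReal⟩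

theorem locallyIntegrable_lnPlusFun : LocallyIntegrable lnPlusFun := by
  have := locallyIntegrable_log.indicator (s := Ioi (0 : ℝ)) measurableSet_Ioi
  refine this.congr (Eventually.of_forall fun x => ?_)
  simp [lnPlusFun, indicator]

theorem locallyIntegrable_lnMinusFun : LocallyIntegrable lnMinusFun := by
  have := locallyIntegrable_log.indicator (s := Iio (0 : ℝ)) measurableSet_Iio
  refine this.congr (Eventually.of_forall fun x => ?_)
  simp [lnMinusFun, indicator]

/-- `ofFun f` is integration against `f` for every locally integrable `f`. -/
theorem ofFun_apply {f : ℝ → ℂ} (hf : LocallyIntegrable f) (ψ : Test) :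
    ofFun f ψ = ∫ x, f x * ψ x := by
  rw [ofFun, TestFunction.integralAgainstBilinCLM_eq_integral (hf.locallyIntegrableOn _)]
  simp [mul_comm]

/-- The distribution `θ`. -/
def theta : Distr := ofFun thetaFun

/-- The distribution `ln x₊`. -/
def lnPlus : Distr := ofFun lnPlusFun

/-- The distribution `ln x₋`. -/
def lnMinus : Distr := ofFun lnMinusFun

/-- The distribution `ln |x| sgn x = ln x₊ - ln x₋`. -/
def lnAbsSgn : Distr := lnPlus - lnMinus

/-- The distribution `x₊^{-p-1} = ((-1)^p / p!) ∂^{p+1} ln x₊ + ((-1)^p κ_p / p!) δ^{(p)}`,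
where `κ_p = ∑_{k=1}^p 1/k`. -/
def xPlusNegSucc (p : ℕ) : Distr :=
  ((-1 : ℂ) ^ p / p.factorial) • pd^[p + 1] lnPlus +
    ((-1 : ℂ) ^ p * (harmonic p : ℂ) / p.factorial) • pd^[p] delta

/-- The distribution `x₋^{-p-1} = (-1 / p!) ∂^{p+1} ln x₋ + (κ_p / p!) δ^{(p)}`. -/
def xMinusNegSucc (p : ℕ) : Distr :=
  ((-1 : ℂ) / p.factorial) • pd^[p + 1] lnMinus +
    ((harmonic p : ℂ) / p.factorial) • pd^[p] delta

/-- The distribution `x^{-p-1} sgn x = x₊^{-p-1} - (-1)^{p+1} x₋^{-p-1}`. -/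
def xNegSuccSgn (p : ℕ) : Distr :=
  xPlusNegSucc p - (-1 : ℂ) ^ (p + 1) • xMinusNegSucc p

/-! ### Operations on test functions -/

/-- The dilation `x ↦ ε⁻¹ φ(ε⁻¹ x)` of a test function (the zero function for `ε = 0`). -/
def dilate (ε : ℝ) (φ : Test) : Test where
  toFun x := (ε : ℂ)⁻¹ * φ (ε⁻¹ * x)
  contDiff' := contDiff_const.mul (φ.contDiff.comp (contDiff_const.mul contDiff_id))
  hasCompactSupport' := by
    rcases eq_or_ne ε 0 with rfl | h
    · simpa using! (HasCompactSupport.zero : HasCompactSupport (0 : ℝ → ℂ))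
    · exact (φ.hasCompactSupport.comp_homeomorph (Homeomorph.mulLeft₀ ε⁻¹ (inv_ne_zero h))).mul_left
  tsupport_subset' := by simp

@[simp] theorem dilate_apply (ε : ℝ) (φ : Test) (x : ℝ) :
    dilate ε φ x = (ε : ℂ)⁻¹ * φ (ε⁻¹ * x) := rfl

/-- The test function `y ↦ ψ(x - y)`. -/
def reflTranslate (x : ℝ) (ψ : Test) : Test where
  toFun y := ψ (x - y)
  contDiff' := ψ.contDiff.comp (contDiff_const.sub contDiff_id)
  hasCompactSupport' := ψ.hasCompactSupport.comp_homeomorph (Homeomorph.subLeft x)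
  tsupport_subset' := by simp

@[simp] theorem reflTranslate_apply (x : ℝ) (ψ : Test) (y : ℝ) :
    reflTranslate x ψ y = ψ (x - y) := rfl

/-- The convolution `(u * ψ)(x) = ⟨u_y, ψ(x - y)⟩` of a distribution and a test function. -/
def conv (u : Distr) (ψ : Test) (x : ℝ) : ℂ := u (reflTranslate x ψ)

theorem dTest_apply (ψ : Test) (x : ℝ) : dTest ψ x = deriv ψ x := by
  rw [TestFunction.lineDerivCLM_apply_of_le (by simp)]
  simp [lineDeriv, deriv_comp_const_add]

theorem coe_dTest_iterate (p : ℕ) (ψ : Test) : ⇑(dTest^[p] ψ) = iteratedDeriv p ψ := by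
  induction p with
  | zero => simp
  | succ p ih =>
    rw [Function.iterate_succ_apply', iteratedDeriv_succ]
    funext x
    rw [dTest_apply, ih]

/-- On test functions supported in a fixed interval a distribution is bounded by finitely many
sup-norms of derivatives. -/
theorem exists_seminorm_bound (u : Distr) (R : ℝ) :
    ∃ (C : ℝ) (N : ℕ), 0 ≤ C ∧ ∀ (χ : Test) (B : ℝ), 0 ≤ B →
      (∀ y, R < |y| → χ y = 0) → (∀ i ≤ N, ∀ y, ‖iteratedDeriv i χ y‖ ≤ B) → ‖u χ‖ ≤ C * B := by
  let K : Compacts ℝ := ⟨Icc (-R) R, isCompact_Icc⟩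
  have hK : (K : Set ℝ) ⊆ (⊤ : Opens ℝ) := by simp
  let T : 𝓓^{⊤}_{K}(ℝ, ℂ) →L[ℂ] ℂ := u ∘L TestFunction.ofSupportedInCLM ℂ hK
  have hc : Continuous ((normSeminorm ℂ ℂ).comp T.toLinearMap) :=
    continuous_norm.comp T.continuous
  obtain ⟨s, C, -, hC⟩ := Seminorm.bound_of_continuous
    (ContDiffMapSupportedIn.withSeminorms ℂ ℝ ℂ ⊤ K) _ hc
  refine ⟨C, s.sup id, C.2, fun χ B hB hs hd => ?_⟩
  have hsupp : Function.support χ ⊆ K := by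
    intro y hy
    by_contra hy'
    refine hy (hs y ?_)
    by_contra h
    exact hy' (abs_le.mp (not_lt.mp h))
  let χK : 𝓓^{⊤}_{K}(ℝ, ℂ) := .of_support_subset χ.contDiff hsupp
  have e : T χK = u χ := rfl
  have h1 : ‖T χK‖ ≤ C * (s.sup (ContDiffMapSupportedIn.seminorm ℂ ℝ ℂ ⊤ K)) χK := hC χK
  rw [← e]
  refine h1.trans (mul_le_mul_of_nonneg_left ?_ C.2)
  refine Seminorm.finset_sup_apply_le hB fun i hi => ?_
  rw [ContDiffMapSupportedIn.seminorm_top_le_iff ℂ hB]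
  intro x _
  rw [norm_iteratedFDeriv_eq_norm_iteratedDeriv]
  exact hd i (Finset.le_sup (f := id) hi) x

theorem iteratedDeriv_reflTranslate (i : ℕ) (x : ℝ) (ψ : Test) (y : ℝ) :
    iteratedDeriv i (reflTranslate x ψ) y = (-1 : ℝ) ^ i • iteratedDeriv i ψ (x - y) := by
  have := congrFun (iteratedDeriv_comp_const_sub i (f := (ψ : ℝ → ℂ)) x) y
  simpa using! this

theorem exists_iteratedDeriv_bound (ψ : Test) (i : ℕ) :
    ∃ M : ℝ, ∀ y, ‖iteratedDeriv i ψ y‖ ≤ M := by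
  rw [← coe_dTest_iterate]
  exact (dTest^[i] ψ).continuous.bounded_above_of_compact_support (dTest^[i] ψ).hasCompactSupport

theorem exists_support_bound (ψ : Test) : ∃ M : ℝ, ∀ y, M < |y| → ψ y = 0 := by
  obtain ⟨M, hM⟩ := ψ.hasCompactSupport.isBounded.exists_norm_le
  refine ⟨M, fun y hy => ?_⟩
  by_contra h
  exact absurd (hM y (subset_tsupport _ h)) (not_le.mpr hy)

theorem taylor_bound {f : ℝ → ℂ} {M : ℝ} (hf : ContDiff ℝ ∞ f)
    (hM : ∀ y, ‖deriv (deriv f) y‖ ≤ M) (a h : ℝ) :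
    ‖f (a + h) - f a - h • deriv f a‖ ≤ M * |h| ^ 2 := by
  have hM0 : 0 ≤ M := (norm_nonneg _).trans (hM 0)
  have hf1 : Differentiable ℝ f := hf.differentiable (by simp)
  have hf2 : Differentiable ℝ (deriv f) :=
    ((contDiff_infty_iff_deriv.mp hf).2).differentiable (by simp)
  have h1 : ∀ t ∈ uIcc a (a + h), ‖deriv f t - deriv f a‖ ≤ M * |h| := by
    intro t ht
    have := (convex_univ (𝕜 := ℝ) (E := ℝ)).norm_image_sub_le_of_norm_deriv_le
      (f := deriv f) (C := M) (fun x _ => hf2 x) (fun x _ => hM x) (mem_univ a) (mem_univ t)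
    refine this.trans (mul_le_mul_of_nonneg_left ?_ hM0)
    have := abs_sub_left_of_mem_uIcc ht
    simpa using this
  have := (convex_uIcc a (a + h)).norm_image_sub_le_of_norm_hasDerivWithin_le
    (f := fun t => f t - t • deriv f a) (f' := fun t => deriv f t - deriv f a) (C := M * |h|)
    (fun t _ => by
      have h2 : HasDerivAt (fun t : ℝ => t • deriv f a) ((1 : ℝ) • deriv f a) t :=
        (hasDerivAt_id t).smul_const _
      simpa using! ((hf1 t).hasDerivAt.sub h2).hasDerivWithinAt) h1 left_mem_uIcc right_mem_uIcc
  have e : f (a + h) - f a - h • deriv f a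
      = (f (a + h) - (a + h) • deriv f a) - (f a - a • deriv f a) := by
    rw [add_smul]; ring
  rw [e]
  refine this.trans (le_of_eq ?_)
  rw [add_sub_cancel_left, Real.norm_eq_abs]
  ring

theorem hasDerivAt_conv (u : Distr) (ψ : Test) (x : ℝ) :
    HasDerivAt (conv u ψ) (conv u (dTest ψ) x) x := by
  obtain ⟨R, hR⟩ := exists_support_bound ψ
  obtain ⟨R', hR'⟩ := exists_support_bound (dTest ψ)
  obtain ⟨C, N, hC, hb⟩ := exists_seminorm_bound u (|x| + 1 + max R R')
  choose M hM using fun i => exists_iteratedDeriv_bound ψ i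
  let B : ℝ := ∑ i ∈ Finset.range (N + 1), |M (i + 2)|
  have hB : 0 ≤ B := Finset.sum_nonneg fun _ _ => abs_nonneg _
  have key : ∀ h : ℝ, |h| ≤ 1 →
      ‖conv u ψ (x + h) - conv u ψ x - h • conv u (dTest ψ) x‖ ≤ C * (B * |h| ^ 2) := by
    intro h hh
    let χ : Test := reflTranslate (x + h) ψ - reflTranslate x ψ - (h : ℂ) • reflTranslate x (dTest ψ)
    have e : conv u ψ (x + h) - conv u ψ x - h • conv u (dTest ψ) x = u χ := by
      simp only [χ, map_sub, map_smul, conv]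
      simp
    have hχ : (χ : ℝ → ℂ) = (reflTranslate (x + h) ψ : ℝ → ℂ) - reflTranslate x ψ
        - (h : ℝ) • (reflTranslate x (dTest ψ) : ℝ → ℂ) := by
      funext y
      simp [χ]
    rw [e]
    refine hb χ _ (by positivity) (fun y hy => ?_) (fun i hi y => ?_)
    · have h1 : max R R' + 1 < |x - y| := by
        have := abs_sub_abs_le_abs_sub y x
        rw [abs_sub_comm] at this
        linarith
      have h2 : max R R' < |x + h - y| := by
        have := abs_sub_abs_le_abs_sub (x - y) (-h)
        rw [abs_neg, sub_neg_eq_add, show x - y + h = x + h - y by ring] at this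
        linarith
      rw [hχ]
      simp only [Pi.sub_apply, Pi.smul_apply, reflTranslate_apply]
      rw [hR _ ((le_max_left _ _).trans_lt h2),
        hR _ ((le_max_left R R').trans_lt (by linarith)),
        hR' _ ((le_max_right R R').trans_lt (by linarith))]
      simp
    · have cd : ∀ (z : ℝ) (φ : Test), ContDiffAt ℝ i (reflTranslate z φ) y := fun z φ =>
        ((reflTranslate z φ).contDiff.of_le (by exact_mod_cast le_top)).contDiffAt
      have e2 : iteratedDeriv i (dTest ψ) (x - y) = deriv (iteratedDeriv i ψ) (x - y) := by
        rw [← iteratedDeriv_succ, iteratedDeriv_succ']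
        rw [show deriv (ψ : ℝ → ℂ) = dTest ψ from funext fun z => (dTest_apply ψ z).symm]
      have cd1 : ContDiffAt ℝ i ((reflTranslate (x + h) ψ : ℝ → ℂ) - (reflTranslate x ψ : ℝ → ℂ)) y :=
        (cd _ _).sub (cd _ _)
      have cd2 : ContDiffAt ℝ i (h • (reflTranslate x (dTest ψ) : ℝ → ℂ)) y :=
        (cd _ _).const_smul h
      rw [hχ, iteratedDeriv_sub cd1 cd2,
        iteratedDeriv_sub (cd _ _) (cd _ _), iteratedDeriv_const_smul (cd _ _),
        iteratedDeriv_reflTranslate, iteratedDeriv_reflTranslate, iteratedDeriv_reflTranslate,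
        smul_comm, ← smul_sub, ← smul_sub, norm_smul, e2]
      have t := taylor_bound (f := iteratedDeriv i ψ) (M := M (i + 2))
        (by rw [← coe_dTest_iterate]; exact (dTest^[i] ψ).contDiff)
        (fun z => by rw [← iteratedDeriv_succ, ← iteratedDeriv_succ]; exact hM (i + 2) z) (x - y) h
      rw [show x + h - y = x - y + h by ring]
      simp only [norm_pow, norm_neg, norm_one, one_pow, one_mul]
      refine t.trans (mul_le_mul_of_nonneg_right ?_ (by positivity))
      exact (le_abs_self _).trans (Finset.single_le_sum (f := fun i => |M (i + 2)|)
        (fun _ _ => abs_nonneg _) (Finset.mem_range.mpr (by omega)))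
  rw [hasDerivAt_iff_isLittleO_nhds_zero]
  refine Asymptotics.IsBigO.trans_isLittleO (g := fun h : ℝ => h ^ 2) ?_ ?_
  · refine Asymptotics.IsBigO.of_bound (C * B) ?_
    filter_upwards [Metric.closedBall_mem_nhds (0 : ℝ) one_pos] with h hh
    have := key h (by simpa using hh)
    simpa [mul_assoc] using this
  · simpa using! Asymptotics.isLittleO_pow_id (𝕜 := ℝ) (n := 2) (by norm_num)

theorem iteratedDeriv_conv (u : Distr) (ψ : Test) (p : ℕ) :
    iteratedDeriv p (conv u ψ) = conv u (dTest^[p] ψ) := by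
  induction p with
  | zero => simp
  | succ p ih =>
    rw [iteratedDeriv_succ, ih, Function.iterate_succ_apply']
    funext x
    exact (hasDerivAt_conv u _ x).deriv

theorem contDiff_conv (u : Distr) (ψ : Test) : ContDiff ℝ ∞ (conv u ψ) := by
  refine contDiff_of_differentiable_iteratedDeriv fun m _ => ?_
  rw [iteratedDeriv_conv]
  exact fun x => (hasDerivAt_conv u _ x).differentiableAt

/-! ### The Colombeau algebra -/

/-- The set `A_q` of test functions with `∫ x^j φ = δ_{0j}` for `j = 0, 1, …, q`. -/
def A (q : ℕ) : Set Test :=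
  {φ | ∀ j ≤ q, ∫ x : ℝ, (x : ℂ) ^ j * φ x = if j = 0 then 1 else 0}

theorem dilate_mem_A {q : ℕ} {φ : Test} (hφ : φ ∈ A q) {ε : ℝ} (hε : 0 < ε) :
    dilate ε φ ∈ A q := by
  intro j hj
  have hc : (ε : ℂ) ≠ 0 := by exact_mod_cast hε.ne'
  have h1 : ∀ x : ℝ, (x : ℂ) ^ j * dilate ε φ x
      = ((ε : ℂ) ^ j * (ε : ℂ)⁻¹) * (((ε⁻¹ * x : ℝ) : ℂ) ^ j * φ (ε⁻¹ * x)) := by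
    intro x
    rw [dilate_apply]
    push_cast
    rw [mul_pow, inv_pow]
    field_simp
  simp_rw [h1]
  rw [integral_const_mul,
    Measure.integral_comp_mul_left (fun x : ℝ => (x : ℂ) ^ j * φ x) ε⁻¹, hφ j hj]
  split_ifs with h
  · subst h
    rw [inv_inv, abs_of_pos hε]
    simp [hc]
  · simp

/-- The parameter set `A_0` of the Colombeau algebra, as a type. -/
abbrev A0 : Type := {φ : Test // φ ∈ A 0}

/-- `φ_ε(x) = ε⁻¹ φ(ε⁻¹ x)` for `ε > 0`; only the behaviour as `ε → 0₊` is ever used, and `φ_ε`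
is given the irrelevant value `φ` for `ε ≤ 0`. -/
def scale (φ : A0) (ε : ℝ) : A0 :=
  if h : 0 < ε then ⟨dilate ε φ.1, dilate_mem_A φ.2 h⟩ else φ

/-- The moderate functions `F(φ, x)`: smooth in `x`, and for all compact `K` and all `p` there is
`q` such that `sup_{x ∈ K} |∂^p F(φ_ε, x)| = O(ε^{-q})` as `ε → 0₊`, for every `φ ∈ A_q`. -/
def IsModerate (F : A0 → ℝ → ℂ) : Prop :=
  (∀ φ, ContDiff ℝ ∞ (F φ)) ∧
  ∀ K : Set ℝ, IsCompact K → ∀ p : ℕ, ∃ q : ℕ, ∀ φ : A0, φ.1 ∈ A q → ∃ C : ℝ,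
    ∀ᶠ ε in 𝓝[>] (0 : ℝ), ∀ x ∈ K, ‖iteratedDeriv p (F (scale φ ε)) x‖ ≤ C * (ε ^ q)⁻¹

/-- The null functions: for all compact `K` and all `p` there is `q` such that
`sup_{x ∈ K} |∂^p F(φ_ε, x)| = O(ε^{r-q})` as `ε → 0₊`, for all `r ≥ q` and `φ ∈ A_r`. -/
def IsNull (F : A0 → ℝ → ℂ) : Prop :=
  ∀ K : Set ℝ, IsCompact K → ∀ p : ℕ, ∃ q : ℕ, ∀ r ≥ q, ∀ φ : A0, φ.1 ∈ A r → ∃ C : ℝ,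
    ∀ᶠ ε in 𝓝[>] (0 : ℝ), ∀ x ∈ K, ‖iteratedDeriv p (F (scale φ ε)) x‖ ≤ C * ε ^ (r - q)

theorem A_anti {q r : ℕ} (h : q ≤ r) : A r ⊆ A q := fun _ hφ j hj => hφ j (hj.trans h)

theorem eventually_Ioc : ∀ᶠ ε in 𝓝[>] (0 : ℝ), ε ∈ Ioc (0 : ℝ) 1 :=
  Ioc_mem_nhdsGT one_pos

theorem IsModerate.exists_uniform {F : A0 → ℝ → ℂ} (hF : IsModerate F) {K : Set ℝ}
    (hK : IsCompact K) (p : ℕ) :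
    ∃ q : ℕ, ∀ φ : A0, φ.1 ∈ A q → ∃ C : ℝ, 0 ≤ C ∧ ∀ᶠ ε in 𝓝[>] (0 : ℝ), ∀ i ≤ p, ∀ x ∈ K,
      ‖iteratedDeriv i (F (scale φ ε)) x‖ ≤ C * (ε ^ q)⁻¹ := by
  choose q hq using hF.2 K hK
  refine ⟨(Finset.range (p + 1)).sup q, fun φ hφ => ?_⟩
  have hle : ∀ i ≤ p, q i ≤ (Finset.range (p + 1)).sup q := fun i hi =>
    Finset.le_sup (Finset.mem_range.mpr (by omega))
  have h : ∀ i, ∃ C : ℝ, i ≤ p → ∀ᶠ ε in 𝓝[>] (0 : ℝ), ∀ x ∈ K,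
      ‖iteratedDeriv i (F (scale φ ε)) x‖ ≤ C * (ε ^ q i)⁻¹ := by
    intro i
    by_cases hi : i ≤ p
    · obtain ⟨C, hC⟩ := hq i φ (A_anti (hle i hi) hφ)
      exact ⟨C, fun _ => hC⟩
    · exact ⟨0, fun h => absurd h hi⟩
  choose C hC using h
  have hall : ∀ᶠ ε in 𝓝[>] (0 : ℝ), ∀ i ∈ Finset.range (p + 1), ∀ x ∈ K,
      ‖iteratedDeriv i (F (scale φ ε)) x‖ ≤ C i * (ε ^ q i)⁻¹ :=
    (Filter.eventually_all_finset _).mpr fun i hi => hC i (by simpa [Nat.lt_succ_iff] using hi)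
  refine ⟨∑ i ∈ Finset.range (p + 1), |C i|, Finset.sum_nonneg fun _ _ => abs_nonneg _, ?_⟩
  filter_upwards [hall, eventually_Ioc] with ε h1 h2 i hi x hx
  have hm : i ∈ Finset.range (p + 1) := Finset.mem_range.mpr (by omega)
  have hε := h2.1
  refine (h1 i hm x hx).trans ?_
  refine mul_le_mul ?_ ?_ (by positivity) (Finset.sum_nonneg fun _ _ => abs_nonneg _)
  · exact (le_abs_self _).trans
      (Finset.single_le_sum (f := fun i => |C i|) (fun _ _ => abs_nonneg _) hm)
  · exact inv_anti₀ (by positivity) (pow_le_pow_of_le_one hε.le h2.2 (hle i hi))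

theorem IsNull.exists_uniform {F : A0 → ℝ → ℂ} (hF : IsNull F) {K : Set ℝ}
    (hK : IsCompact K) (p : ℕ) :
    ∃ q : ℕ, ∀ r ≥ q, ∀ φ : A0, φ.1 ∈ A r → ∃ C : ℝ, 0 ≤ C ∧
      ∀ᶠ ε in 𝓝[>] (0 : ℝ), ∀ i ≤ p, ∀ x ∈ K,
        ‖iteratedDeriv i (F (scale φ ε)) x‖ ≤ C * ε ^ (r - q) := by
  choose q hq using hF K hK
  refine ⟨(Finset.range (p + 1)).sup q, fun r hr φ hφ => ?_⟩
  have hle : ∀ i ≤ p, q i ≤ (Finset.range (p + 1)).sup q := fun i hi =>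
    Finset.le_sup (Finset.mem_range.mpr (by omega))
  have h : ∀ i, ∃ C : ℝ, i ≤ p → ∀ᶠ ε in 𝓝[>] (0 : ℝ), ∀ x ∈ K,
      ‖iteratedDeriv i (F (scale φ ε)) x‖ ≤ C * ε ^ (r - q i) := by
    intro i
    by_cases hi : i ≤ p
    · obtain ⟨C, hC⟩ := hq i r ((hle i hi).trans hr) φ hφ
      exact ⟨C, fun _ => hC⟩
    · exact ⟨0, fun h => absurd h hi⟩
  choose C hC using h
  have hall : ∀ᶠ ε in 𝓝[>] (0 : ℝ), ∀ i ∈ Finset.range (p + 1), ∀ x ∈ K,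
      ‖iteratedDeriv i (F (scale φ ε)) x‖ ≤ C i * ε ^ (r - q i) :=
    (Filter.eventually_all_finset _).mpr fun i hi => hC i (by simpa [Nat.lt_succ_iff] using hi)
  refine ⟨∑ i ∈ Finset.range (p + 1), |C i|, Finset.sum_nonneg fun _ _ => abs_nonneg _, ?_⟩
  filter_upwards [hall, eventually_Ioc] with ε h1 h2 i hi x hx
  have hm : i ∈ Finset.range (p + 1) := Finset.mem_range.mpr (by omega)
  have hε := h2.1
  refine (h1 i hm x hx).trans ?_
  refine mul_le_mul ?_ ?_ (by positivity) (Finset.sum_nonneg fun _ _ => abs_nonneg _)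
  · exact (le_abs_self _).trans
      (Finset.single_le_sum (f := fun i => |C i|) (fun _ _ => abs_nonneg _) hm)
  · exact pow_le_pow_of_le_one hε.le h2.2 (by have := hle i hi; omega)

theorem norm_iteratedDeriv_mul_le' {f g : ℝ → ℂ} (hf : ContDiff ℝ ∞ f) (hg : ContDiff ℝ ∞ g)
    {p : ℕ} {x a b : ℝ} (ha : 0 ≤ a) (hfa : ∀ i ≤ p, ‖iteratedDeriv i f x‖ ≤ a)
    (hgb : ∀ i ≤ p, ‖iteratedDeriv i g x‖ ≤ b) :
    ‖iteratedDeriv p (f * g) x‖ ≤ 2 ^ p * (a * b) := by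
  have h := norm_iteratedFDeriv_mul_le hf hg x (n := p) (by exact_mod_cast le_top)
  simp only [norm_iteratedFDeriv_eq_norm_iteratedDeriv] at h
  refine h.trans ?_
  calc _ ≤ ∑ i ∈ Finset.range (p + 1), (p.choose i : ℝ) * (a * b) := by
        refine Finset.sum_le_sum fun i hi => ?_
        rw [mul_assoc]
        refine mul_le_mul_of_nonneg_left ?_ (by positivity)
        exact mul_le_mul (hfa i (by simpa [Nat.lt_succ_iff] using hi)) (hgb _ (by omega))
          (norm_nonneg _) ha
    _ = 2 ^ p * (a * b) := by
        rw [← Finset.sum_mul]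
        exact_mod_cast congrArg (fun n : ℕ => (n : ℝ) * (a * b)) (Nat.sum_range_choose p)

theorem IsModerate.add {F G : A0 → ℝ → ℂ} (hF : IsModerate F) (hG : IsModerate G) :
    IsModerate (F + G) := by
  refine ⟨fun φ => (hF.1 φ).add (hG.1 φ), fun K hK p => ?_⟩
  obtain ⟨q₁, h₁⟩ := hF.2 K hK p
  obtain ⟨q₂, h₂⟩ := hG.2 K hK p
  refine ⟨max q₁ q₂, fun φ hφ => ?_⟩
  obtain ⟨C₁, h₁⟩ := h₁ φ (A_anti (le_max_left _ _) hφ)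
  obtain ⟨C₂, h₂⟩ := h₂ φ (A_anti (le_max_right _ _) hφ)
  refine ⟨|C₁| + |C₂|, ?_⟩
  filter_upwards [h₁, h₂, eventually_Ioc] with ε h₁ h₂ h₃ x hx
  have hε := h₃.1
  have cd : ∀ {H : A0 → ℝ → ℂ}, IsModerate H → ContDiffAt ℝ p (H (scale φ ε)) x := fun hH =>
    ((hH.1 _).of_le (by exact_mod_cast le_top)).contDiffAt
  rw [Pi.add_apply, iteratedDeriv_add (cd hF) (cd hG), add_mul]
  refine (norm_add_le _ _).trans (add_le_add ((h₁ x hx).trans ?_) ((h₂ x hx).trans ?_))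
  · exact mul_le_mul (le_abs_self _) (inv_anti₀ (by positivity)
      (pow_le_pow_of_le_one hε.le h₃.2 (le_max_left _ _))) (by positivity) (abs_nonneg _)
  · exact mul_le_mul (le_abs_self _) (inv_anti₀ (by positivity)
      (pow_le_pow_of_le_one hε.le h₃.2 (le_max_right _ _))) (by positivity) (abs_nonneg _)

theorem IsModerate.mul {F G : A0 → ℝ → ℂ} (hF : IsModerate F) (hG : IsModerate G) :
    IsModerate (F * G) := by
  refine ⟨fun φ => (hF.1 φ).mul (hG.1 φ), fun K hK p => ?_⟩
  obtain ⟨q₁, h₁⟩ := hF.exists_uniform hK p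
  obtain ⟨q₂, h₂⟩ := hG.exists_uniform hK p
  refine ⟨q₁ + q₂, fun φ hφ => ?_⟩
  obtain ⟨C₁, hC₁, h₁⟩ := h₁ φ (A_anti (Nat.le_add_right _ _) hφ)
  obtain ⟨C₂, hC₂, h₂⟩ := h₂ φ (A_anti (Nat.le_add_left _ _) hφ)
  refine ⟨2 ^ p * (C₁ * C₂), ?_⟩
  filter_upwards [h₁, h₂, eventually_Ioc] with ε h₁ h₂ h₃ x hx
  have hε := h₃.1
  refine (norm_iteratedDeriv_mul_le' (hF.1 _) (hG.1 _) (by positivity)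
    (fun i hi => h₁ i hi x hx) (fun i hi => h₂ i hi x hx)).trans (le_of_eq ?_)
  rw [pow_add, mul_inv]
  ring

theorem isModerate_const (c : ℂ) : IsModerate (fun _ _ => c) := by
  refine ⟨fun _ => contDiff_const, fun K _ p => ⟨0, fun φ _ => ⟨‖c‖, Eventually.of_forall ?_⟩⟩⟩
  intro ε x _
  rw [iteratedDeriv_const]
  split_ifs <;> simp

theorem IsNull.add {F G : A0 → ℝ → ℂ} (mF : IsModerate F) (mG : IsModerate G)
    (hF : IsNull F) (hG : IsNull G) : IsNull (F + G) := by
  intro K hK p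
  obtain ⟨q₁, h₁⟩ := hF K hK p
  obtain ⟨q₂, h₂⟩ := hG K hK p
  refine ⟨max q₁ q₂, fun r hr φ hφ => ?_⟩
  obtain ⟨C₁, h₁⟩ := h₁ r ((le_max_left _ _).trans hr) φ hφ
  obtain ⟨C₂, h₂⟩ := h₂ r ((le_max_right _ _).trans hr) φ hφ
  refine ⟨|C₁| + |C₂|, ?_⟩
  filter_upwards [h₁, h₂, eventually_Ioc] with ε h₁ h₂ h₃ x hx
  have hε := h₃.1
  have cd : ∀ {H : A0 → ℝ → ℂ}, IsModerate H → ContDiffAt ℝ p (H (scale φ ε)) x := fun hH =>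
    ((hH.1 _).of_le (by exact_mod_cast le_top)).contDiffAt
  rw [Pi.add_apply, iteratedDeriv_add (cd mF) (cd mG), add_mul]
  refine (norm_add_le _ _).trans (add_le_add ((h₁ x hx).trans ?_) ((h₂ x hx).trans ?_))
  · exact mul_le_mul (le_abs_self _) (pow_le_pow_of_le_one hε.le h₃.2 (by omega))
      (by positivity) (abs_nonneg _)
  · exact mul_le_mul (le_abs_self _) (pow_le_pow_of_le_one hε.le h₃.2 (by omega))
      (by positivity) (abs_nonneg _)

theorem IsNull.mul_left {F G : A0 → ℝ → ℂ} (mF : IsModerate F) (mG : IsModerate G)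
    (hG : IsNull G) : IsNull (F * G) := by
  intro K hK p
  obtain ⟨q₁, h₁⟩ := mF.exists_uniform hK p
  obtain ⟨q₂, h₂⟩ := hG.exists_uniform hK p
  refine ⟨q₁ + q₂, fun r hr φ hφ => ?_⟩
  obtain ⟨C₁, hC₁, h₁⟩ := h₁ φ (A_anti (by omega) hφ)
  obtain ⟨C₂, hC₂, h₂⟩ := h₂ r (by omega) φ hφ
  refine ⟨2 ^ p * (C₁ * C₂), ?_⟩
  filter_upwards [h₁, h₂, eventually_Ioc] with ε h₁ h₂ h₃ x hx
  have hε := h₃.1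
  refine (norm_iteratedDeriv_mul_le' (mF.1 _) (mG.1 _) (by positivity)
    (fun i hi => h₁ i hi x hx) (fun i hi => h₂ i hi x hx)).trans (le_of_eq ?_)
  rw [show r - q₂ = q₁ + (r - (q₁ + q₂)) by omega, pow_add]
  field_simp

/-- The algebra of moderate functions, with pointwise operations. -/
def moderate : Subalgebra ℂ (A0 → ℝ → ℂ) where
  carrier := {F | IsModerate F}
  mul_mem' := IsModerate.mul
  add_mem' := IsModerate.add
  algebraMap_mem' := isModerate_const

/-- The ideal of null functions in the algebra of moderate functions. -/
def nullIdeal : Ideal moderate where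
  carrier := {F | IsNull F.1}
  add_mem' := fun {F G} hF hG => IsNull.add F.2 G.2 hF hG
  zero_mem' := by
    intro K _ p
    refine ⟨0, fun r _ φ _ => ⟨0, Eventually.of_forall fun ε x _ => ?_⟩⟩
    have : iteratedDeriv p (fun _ : ℝ => (0 : ℂ)) x = 0 := by simp
    exact (norm_eq_zero.mpr this).le.trans (by simp)
  smul_mem' := fun F G hG => IsNull.mul_left F.2 G.2 hG

/-- The Colombeau algebra `𝓖(ℝ)` of generalized functions. -/
abbrev GenFun : Type := moderate ⧸ nullIdeal

/-- `F ≈ u`: the generalized function `F` is associated with the distribution `u`, i.e. for some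
representative `f` of `F` and every test function `ψ` there is `q` such that
`∫ f(φ_ε, x) ψ(x) dx → ⟨u, ψ⟩` as `ε → 0₊`, for every `φ ∈ A_q`. -/
def AssociatedWith (F : GenFun) (u : Distr) : Prop :=
  ∃ f : moderate, Ideal.Quotient.mk nullIdeal f = F ∧
    ∀ ψ : Test, ∃ q : ℕ, ∀ φ : A0, φ.1 ∈ A q →
      Tendsto (fun ε : ℝ => ∫ x : ℝ, f.1 (scale φ ε) x * ψ x) (𝓝[>] 0) (𝓝 (u ψ))

/-! ### Modelling of singularities -/

/-- `s(φ) = sup {|x| : φ(x) ≠ 0}`. -/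
def size (φ : Test) : ℝ := sSup {r : ℝ | ∃ x : ℝ, φ x ≠ 0 ∧ r = |x|}

/-- A family `D(s, ·)`, `s > 0`, of even test functions with
`∫ D(s, x) dx = (1/s) ∫ D(s, x)² dx = 1`, whose supports lie in a common interval `[-l, l]` and
whose derivatives of each order are uniformly bounded, for small `s`. The standard example is
`D(s, x) = f(x) + λ_s g(x)`, see `DeltaFamily.ofPair`. -/
structure DeltaFamily where
  /-- The test function `D(s, ·)`; only the values at `s > 0` matter. -/
  toFun : ℝ → Test
  even : ∀ s > 0, ∀ x, toFun s (-x) = toFun s x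
  integral_eq_one : ∀ s > 0, ∫ x : ℝ, toFun s x = 1
  integral_sq : ∀ s : ℝ, s > 0 → (1 / (s : ℂ)) * ∫ x : ℝ, toFun s x ^ 2 = 1
  support_bound : ∃ l : ℝ, ∀ᶠ s in 𝓝[>] (0 : ℝ), ∀ x, l < |x| → toFun s x = 0
  deriv_bound : ∀ k : ℕ, ∃ C : ℝ, ∀ᶠ s in 𝓝[>] (0 : ℝ), ∀ x, ‖iteratedDeriv k (toFun s) x‖ ≤ C

theorem size_pos (φ : A0) : 0 < size φ.1 := by
  obtain ⟨M, hM⟩ := exists_support_bound φ.1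
  have hne : ∃ x : ℝ, φ.1 x ≠ 0 ∧ x ≠ 0 := by
    by_contra! h
    have h0 : ∫ x : ℝ, φ.1 x = 0 := by
      rw [integral_eq_zero_of_ae]
      have : ∀ᵐ x : ℝ, x ≠ 0 := by simp [ae_iff]
      filter_upwards [this] with x hx
      by_contra h'
      exact hx (h x h')
    have h1 := φ.2 0 le_rfl
    simp [h0] at h1
  obtain ⟨x, hx, hx0⟩ := hne
  refine (abs_pos.mpr hx0).trans_le (le_csSup ⟨M, ?_⟩ ⟨x, hx, rfl⟩)
  rintro r ⟨y, hy, rfl⟩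
  by_contra h
  exact hy (hM y (not_le.mp h))

open scoped Pointwise in
theorem size_dilate {ε : ℝ} (hε : 0 < ε) (φ : Test) : size (dilate ε φ) = ε * size φ := by
  have hs : {r : ℝ | ∃ x : ℝ, dilate ε φ x ≠ 0 ∧ r = |x|}
      = ε • {r : ℝ | ∃ x : ℝ, φ x ≠ 0 ∧ r = |x|} := by
    ext r
    simp only [mem_smul_set, mem_ofPred_eq, dilate_apply, smul_eq_mul]
    constructor
    · rintro ⟨x, hx, rfl⟩
      refine ⟨|ε⁻¹ * x|, ⟨ε⁻¹ * x, right_ne_zero_of_mul hx, rfl⟩, ?_⟩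
      rw [abs_mul, abs_of_pos (inv_pos.mpr hε), mul_inv_cancel_left₀ hε.ne']
    · rintro ⟨_, ⟨x, hx, rfl⟩, rfl⟩
      refine ⟨ε * x, mul_ne_zero (by simp [hε.ne']) ?_, by rw [abs_mul, abs_of_pos hε]⟩
      rwa [inv_mul_cancel_left₀ hε.ne']
  rw [size, hs, Real.sSup_smul_of_nonneg hε.le, size, smul_eq_mul]

theorem iteratedDeriv_dilate (i : ℕ) (ε : ℝ) (φ : Test) (x : ℝ) :
    iteratedDeriv i (dilate ε φ) x = (ε : ℂ)⁻¹ ^ (i + 1) * iteratedDeriv i φ (ε⁻¹ * x) := by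
  induction i generalizing x with
  | zero => simp
  | succ i ih =>
    have hd : HasDerivAt (iteratedDeriv i φ) (iteratedDeriv (i + 1) φ (ε⁻¹ * x)) (ε⁻¹ * x) := by
      rw [iteratedDeriv_succ, ← coe_dTest_iterate]
      exact ((dTest^[i] φ).contDiff.differentiable (by simp) _).hasDerivAt
    have h2 : HasDerivAt (fun x : ℝ => ε⁻¹ * x) ε⁻¹ x := by
      simpa using (hasDerivAt_id x).const_mul ε⁻¹
    have h3 := (hd.scomp x h2).const_mul ((ε : ℂ)⁻¹ ^ (i + 1))
    rw [iteratedDeriv_succ, funext ih]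
    refine h3.deriv.trans ?_
    rw [Complex.real_smul]
    push_cast
    ring

namespace DeltaFamily

/-- The test function `D_σ(x) = σ⁻¹ D(σ, x/σ)`. -/
def net (D : DeltaFamily) (σ : ℝ) : Test := dilate σ (D.toFun σ)

/-- The representative `(φ, x) ↦ (u * D_σ)(x)`, `σ = s(φ)`, of the model of `u`. -/
def rep (D : DeltaFamily) (u : Distr) (φ : A0) (x : ℝ) : ℂ := conv u (D.net (size φ.1)) x

theorem isModerate_rep (D : DeltaFamily) (u : Distr) : IsModerate (D.rep u) := by
  refine ⟨fun φ => contDiff_conv u _, fun K hK p => ?_⟩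
  obtain ⟨R, hR⟩ := hK.isBounded.exists_norm_le
  obtain ⟨l, hl⟩ := D.support_bound
  choose M hM using D.deriv_bound
  obtain ⟨C, N, hC, hb⟩ := exists_seminorm_bound u (R + |l|)
  refine ⟨N + p + 1, fun φ _ => ?_⟩
  have hs := size_pos φ
  let B : ℝ := ∑ i ∈ Finset.range (N + 1), |M (i + p)|
  have hB : 0 ≤ B := Finset.sum_nonneg fun _ _ => abs_nonneg _
  refine ⟨C * (B * (size φ.1 ^ (N + p + 1))⁻¹), ?_⟩
  have ht : Tendsto (fun ε : ℝ => ε * size φ.1) (𝓝[>] 0) (𝓝[>] 0) := by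
    refine tendsto_nhdsWithin_iff.mpr ⟨?_, ?_⟩
    · have : Tendsto (fun ε : ℝ => ε * size φ.1) (𝓝 0) (𝓝 (0 * size φ.1)) :=
        tendsto_id.mul_const _
      rw [zero_mul] at this
      exact this.mono_left nhdsWithin_le_nhds
    · filter_upwards [self_mem_nhdsWithin] with ε hε
      exact mul_pos hε hs
  have hall : ∀ᶠ s in 𝓝[>] (0 : ℝ), ∀ i ∈ Finset.range (N + 1),
      ∀ x, ‖iteratedDeriv (i + p) (D.toFun s) x‖ ≤ M (i + p) :=
    (Filter.eventually_all_finset _).mpr fun i _ => hM (i + p)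
  filter_upwards [self_mem_nhdsWithin, ht.eventually hl, ht.eventually hall,
    ht.eventually eventually_Ioc] with ε hε h1 h2 h3 x hx
  have hε' : 0 < ε := hε
  set σ := ε * size φ.1 with hσ
  have hσ0 : 0 < σ := h3.1
  have e : D.rep u (scale φ ε) = conv u (D.net σ) := by
    funext y
    rw [rep, scale, dif_pos hε', size_dilate hε']
  rw [e, iteratedDeriv_conv, conv]
  have hexp : C * (B * (size φ.1 ^ (N + p + 1))⁻¹) * (ε ^ (N + p + 1))⁻¹
      = C * (B * (σ ^ (N + p + 1))⁻¹) := by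
    rw [hσ, mul_pow, mul_inv]; ring
  rw [hexp]
  refine hb _ _ (by positivity) (fun y hy => ?_) (fun i hi y => ?_)
  · rw [reflTranslate_apply, coe_dTest_iterate, net, iteratedDeriv_dilate]
    have hxR := hR x hx
    rw [Real.norm_eq_abs] at hxR
    have h4 : |l| < |x - y| := by
      have := abs_sub_abs_le_abs_sub y x
      rw [abs_sub_comm] at this
      linarith
    have h5 : |l| < |σ⁻¹ * (x - y)| := by
      rw [abs_mul, abs_of_pos (inv_pos.mpr hσ0)]
      refine h4.trans_le (le_mul_of_one_le_left (abs_nonneg _) ?_)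
      exact (one_le_inv₀ hσ0).mpr h3.2
    have h6 : (D.toFun σ : ℝ → ℂ) =ᶠ[𝓝 (σ⁻¹ * (x - y))] fun _ => 0 := by
      have : {z : ℝ | |l| < |z|} ∈ 𝓝 (σ⁻¹ * (x - y)) :=
        (isOpen_lt continuous_const continuous_abs).mem_nhds h5
      filter_upwards [this] with z hz
      exact h1 z ((le_abs_self l).trans_lt hz)
    rw [h6.iteratedDeriv_eq]
    simp
  · rw [iteratedDeriv_reflTranslate, norm_smul, ← coe_dTest_iterate, ← Function.iterate_add_apply,
      coe_dTest_iterate, net, iteratedDeriv_dilate]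
    simp only [norm_pow, norm_neg, norm_one, one_pow, one_mul, norm_mul, norm_inv,
      Complex.norm_real, Real.norm_eq_abs, abs_of_pos hσ0]
    rw [mul_comm]
    refine mul_le_mul ?_ ?_ (by positivity) hB
    · refine (h2 i (Finset.mem_range.mpr (by omega)) _).trans ?_
      exact (le_abs_self _).trans (Finset.single_le_sum (f := fun i => |M (i + p)|)
        (fun _ _ => abs_nonneg _) (Finset.mem_range.mpr (by omega)))
    · rw [inv_pow]
      exact inv_anti₀ (by positivity) (pow_le_pow_of_le_one hσ0.le h3.2 (by omega))

/-- The generalized function modelling the distribution `u`: the class of `u * D_σ`. -/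
def model (D : DeltaFamily) (u : Distr) : GenFun :=
  Ideal.Quotient.mk nullIdeal ⟨D.rep u, D.isModerate_rep u⟩

/-- A real-valued test function, regarded as complex-valued. -/
def ofRealTest (f : 𝓓((⊤ : Opens ℝ), ℝ)) : Test := TestFunction.postcompCLM Complex.ofRealCLM f

@[simp] theorem ofRealTest_apply (f : 𝓓((⊤ : Opens ℝ), ℝ)) (x : ℝ) : ofRealTest f x = f x := rfl

theorem integral_sq_ofPair (f g : 𝓓((⊤ : Opens ℝ), ℝ)) (c : ℂ)
    (hfg : Disjoint (Function.support f) (Function.support g)) (hg0 : g ≠ 0) {s : ℝ} (hs : s > 0)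
    (hc : c ^ 2 = (((s - ∫ x : ℝ, f x ^ 2) / ∫ x : ℝ, g x ^ 2 : ℝ) : ℂ)) :
    (1 / (s : ℂ)) * ∫ x : ℝ, (ofRealTest f + c • ofRealTest g) x ^ 2 = 1 := by
  have hi : ∀ h : 𝓓((⊤ : Opens ℝ), ℝ), Integrable (fun x => h x ^ 2) := by
    intro h
    have hcs : HasCompactSupport (fun x => h x ^ 2) := by
      refine h.hasCompactSupport.mono fun x hx h0 => hx ?_
      simp [h0]
    exact (h.continuous.pow 2).integrable_of_hasCompactSupport hcs
  have hgpos : 0 < ∫ x : ℝ, g x ^ 2 := by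
    obtain ⟨x, hx⟩ : ∃ x, g x ≠ 0 := by
      by_contra! h
      exact hg0 (TestFunction.ext h)
    have hpos : 0 < g x ^ 2 := by positivity
    rw [integral_pos_iff_support_of_nonneg (fun x => sq_nonneg (g x)) (hi g)]
    have ho : IsOpen (Function.support fun x => g x ^ 2) :=
      (g.continuous.pow 2).isOpen_support
    exact ho.measure_pos _ ⟨x, hpos.ne'⟩
  have hfi : Integrable (fun x => ((f x ^ 2 : ℝ) : ℂ)) := (hi f).ofReal
  have hgi : Integrable (fun x => ((g x ^ 2 : ℝ) : ℂ)) := (hi g).ofReal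
  have hmul : ∀ x, f x * g x = 0 := by
    intro x
    by_contra h
    exact Set.disjoint_left.mp hfg (left_ne_zero_of_mul h : f x ≠ 0)
      (right_ne_zero_of_mul h : g x ≠ 0)
  have hint : ∫ x : ℝ, ((f x : ℂ) + c * (g x : ℂ)) ^ 2 = s := by
    have e : ∀ x, ((f x : ℂ) + c * (g x : ℂ)) ^ 2
        = ((f x ^ 2 : ℝ) : ℂ) + c ^ 2 * ((g x ^ 2 : ℝ) : ℂ) := by
      intro x
      have : (f x : ℂ) * (g x : ℂ) = 0 := by exact_mod_cast hmul x
      push_cast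
      linear_combination (2 * c) * this
    simp_rw [e]
    rw [integral_add hfi (hgi.const_mul _), integral_const_mul, integral_complex_ofReal,
      integral_complex_ofReal, hc]
    rw [← Complex.ofReal_mul, div_mul_cancel₀ _ hgpos.ne', ← Complex.ofReal_add]
    simp
  have hs' : (s : ℂ) ≠ 0 := by exact_mod_cast (ne_of_gt hs)
  have : (1 / (s : ℂ)) * ∫ x : ℝ, ((f x : ℂ) + c * (g x : ℂ)) ^ 2 = 1 := by
    rw [hint]; field_simp
  simpa using this

/-- The family `D(s, x) = f(x) + λ_s g(x)`, where `f, g` are real-valued even test functions with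
disjoint supports, `∫ f = 1`, `∫ g = 0`, `g ≠ 0` and `λ_s² = (s - ∫ f²) / ∫ g²`. -/
def ofPair (f g : 𝓓((⊤ : Opens ℝ), ℝ)) (lam : ℝ → ℂ)
    (hfe : ∀ x, f (-x) = f x) (hge : ∀ x, g (-x) = g x)
    (hfg : Disjoint (Function.support f) (Function.support g))
    (hf : ∫ x : ℝ, f x = 1) (hg : ∫ x : ℝ, g x = 0) (hg0 : g ≠ 0)
    (hlam : ∀ s > 0, lam s ^ 2 = (((s - ∫ x : ℝ, f x ^ 2) / ∫ x : ℝ, g x ^ 2 : ℝ) : ℂ)) :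
    DeltaFamily where
  toFun s := ofRealTest f
    + lam s • ofRealTest g
  even s _ x := by simp [hfe, hge]
  integral_eq_one s _ := by
    have hfi : Integrable (fun x => (f x : ℂ)) :=
      (f.continuous.integrable_of_hasCompactSupport f.hasCompactSupport).ofReal
    have hgi : Integrable (fun x => (g x : ℂ)) :=
      (g.continuous.integrable_of_hasCompactSupport g.hasCompactSupport).ofReal
    have : ∫ x : ℝ, ((f x : ℂ) + lam s * (g x : ℂ)) = 1 := by
      rw [integral_add hfi (hgi.const_mul _), integral_const_mul, integral_complex_ofReal,
        integral_complex_ofReal, hf, hg]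
      simp
    simpa using this
  integral_sq s hs := integral_sq_ofPair f g (lam s) hfg hg0 hs (hlam s hs)
  support_bound := by
    obtain ⟨M₁, h₁⟩ := exists_support_bound (ofRealTest f)
    obtain ⟨M₂, h₂⟩ := exists_support_bound (ofRealTest g)
    refine ⟨max M₁ M₂, Eventually.of_forall fun s x hx => ?_⟩
    have e : (ofRealTest f + lam s • ofRealTest g) x
        = ofRealTest f x + lam s * ofRealTest g x := rfl
    rw [e, h₁ x ((le_max_left _ _).trans_lt hx), h₂ x ((le_max_right _ _).trans_lt hx)]
    simp
  deriv_bound k := by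
    set F : Test := ofRealTest f
    set G : Test := ofRealTest g
    obtain ⟨M₁, h₁⟩ := exists_iteratedDeriv_bound F k
    obtain ⟨M₂, h₂⟩ := exists_iteratedDeriv_bound G k
    set a : ℝ := ∫ x : ℝ, f x ^ 2
    set b : ℝ := ∫ x : ℝ, g x ^ 2
    refine ⟨M₁ + (1 + (1 + |a|) / |b|) * M₂, ?_⟩
    filter_upwards [eventually_Ioc] with s hs x
    have hl : ‖lam s‖ ≤ 1 + (1 + |a|) / |b| := by
      have h3 : ‖lam s‖ ^ 2 ≤ (1 + |a|) / |b| := by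
        rw [← norm_pow, hlam s hs.1, Complex.norm_real, Real.norm_eq_abs, abs_div]
        refine div_le_div_of_nonneg_right ?_ (abs_nonneg _)
        refine (abs_sub _ _).trans ?_
        rw [abs_of_pos hs.1]
        linarith [hs.2]
      nlinarith [norm_nonneg (lam s), sq_nonneg (‖lam s‖ - 1)]
    have cd : ∀ H : Test, ContDiffAt ℝ k H x := fun H =>
      (H.contDiff.of_le (by exact_mod_cast le_top)).contDiffAt
    have e : ⇑(F + lam s • G) = (F : ℝ → ℂ) + lam s • (G : ℝ → ℂ) := by
      funext y; simp
    have cd2 : ContDiffAt ℝ k (lam s • (G : ℝ → ℂ)) x := (cd G).const_smul (lam s)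
    rw [e, iteratedDeriv_add (cd F) cd2, iteratedDeriv_const_smul (cd G)]
    refine (norm_add_le _ _).trans (add_le_add (h₁ x) ?_)
    rw [norm_smul]
    exact mul_le_mul hl (h₂ x) (norm_nonneg _) (by positivity)

end DeltaFamily


end Colombeau

end

/-!
Write `[u] = u * d` for an even test function `d = D_σ`. Since `[u]' = [∂u]`, `[δ] = d` and
`∂θ = δ`, the Leibniz rule turns the two products into exact linear combinations of derivatives of
`[f][θ]` with `f` locally integrable, `[ln|x| sgn x][δ]`, `[∂ ln|x|][δ]` and `[δ]²`. Differentiation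
is weakly continuous, so only the weak limits of these as `σ → 0` are needed.

* `[f][θ] → f θ` by dominated convergence, because `θ` is bounded and continuous off `0`.
* The other three are supported in an interval of length `O(σ)`, so by Taylor's formula only their
  integrals and first moments matter: `[δ]² → δ` because `∫ D_σ² = 1`, and `[ln|x| sgn x][δ] → 0`
  because `ln|x| sgn x` is odd and `ln` is integrable at `0`.
* `[∂ ln|x|][δ]` is odd too, but `x ∂ ln|x| = 1` forces its first moment to be `1/2` for every `σ`,
  so it tends to `-δ'/2`. In the second product this and the limit `-δ'/2` of `-[θ]²''/2` make up
  the `-δ'` in `x₊⁻²`.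
-/

noncomputable section

namespace Colombeau

open Set Filter Topology MeasureTheory TopologicalSpace
open scoped Distributions ContDiff Convolution

@[fun_prop]
theorem continuous_conv (u : Distr) (a : Test) : Continuous (conv u a) :=
  (contDiff_conv u a).continuous

theorem hasDerivAt_dTest (a : Test) (x : ℝ) : HasDerivAt a (dTest a x) x := by
  rw [dTest_apply]
  exact (a.contDiff.differentiable (by simp) x).hasDerivAt

theorem pd_apply (u : Distr) (ψ : Test) : pd u ψ = -u (dTest ψ) := rfl

theorem pd_add (u v : Distr) : pd (u + v) = pd u + pd v := by
  rw [pd, ContinuousLinearMap.add_comp, neg_add]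
  rfl

theorem pd_sub (u v : Distr) : pd (u - v) = pd u - pd v := by
  rw [pd, ContinuousLinearMap.sub_comp, neg_sub']
  rfl

theorem conv_add (u v : Distr) (a : Test) : conv (u + v) a = conv u a + conv v a := rfl

theorem conv_sub (u v : Distr) (a : Test) : conv (u - v) a = conv u a - conv v a := rfl

theorem conv_neg (u : Distr) (a : Test) : conv (-u) a = -conv u a := rfl

theorem conv_smul (c : ℂ) (u : Distr) (a : Test) : conv (c • u) a = c • conv u a := rfl

theorem dTest_reflTranslate (x : ℝ) (a : Test) :
    dTest (reflTranslate x a) = -reflTranslate x (dTest a) := by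
  ext y
  have h : HasDerivAt (reflTranslate x a) (dTest a (x - y) * -1) y :=
    (hasDerivAt_dTest a (x - y)).scomp_of_eq y ((hasDerivAt_id y).const_sub x) rfl |>.congr_deriv
      (by simp)
  rw [dTest_apply, h.deriv, mul_neg_one]
  rfl

theorem conv_pd (u : Distr) (a : Test) : conv (pd u) a = conv u (dTest a) := by
  ext x
  rw [conv, pd_apply, dTest_reflTranslate, map_neg, neg_neg, conv]

theorem conv_delta (a : Test) : conv delta a = a := by
  ext x
  change reflTranslate x a 0 = a x
  rw [reflTranslate_apply, sub_zero]

theorem deriv_conv (u : Distr) (a : Test) : deriv (conv u a) = conv (pd u) a := by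
  ext x
  rw [(hasDerivAt_conv u a x).deriv, conv_pd]

theorem deriv_conv_mul_conv (u v : Distr) (a : Test) :
    deriv (conv u a * conv v a) = conv (pd u) a * conv v a + conv u a * conv (pd v) a := by
  ext x
  rw [((hasDerivAt_conv u a x).mul (hasDerivAt_conv v a x)).deriv, conv_pd, conv_pd]
  rfl

theorem deriv_deriv_conv_mul_conv (u v : Distr) (a : Test) :
    deriv (deriv (conv u a * conv v a)) =
      conv (pd (pd u)) a * conv v a + 2 * (conv (pd u) a * conv (pd v) a) +
        conv u a * conv (pd (pd v)) a := by
  have hd (u v : Distr) : Differentiable ℝ (conv u a * conv v a) :=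
    ((contDiff_conv u a).mul (contDiff_conv v a)).differentiable (by simp)
  ext x
  rw [deriv_conv_mul_conv, deriv_add (hd _ _ x) (hd _ _ x), deriv_conv_mul_conv,
    deriv_conv_mul_conv]
  simp only [Pi.add_apply, Pi.mul_apply, Pi.ofNat_apply]
  ring

theorem pd_theta : pd theta = delta := by
  ext ψ
  have h (x : ℝ) : thetaFun x * dTest ψ x = (Ioi (0 : ℝ)).indicator (deriv ψ) x := by
    rw [dTest_apply]
    simp [thetaFun, indicator]
  rw [pd_apply, theta, ofFun_apply locallyIntegrable_thetaFun,
    integral_congr_ae (Eventually.of_forall h), integral_indicator measurableSet_Ioi,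
    HasCompactSupport.integral_Ioi_deriv_eq (ψ.contDiff.of_le (by simp)) ψ.hasCompactSupport,
    neg_neg]
  rfl

theorem integrable_mul_test {f : ℝ → ℂ} (hf : LocallyIntegrable f) (ψ : Test) :
    Integrable fun x => f x * ψ x := by
  simpa using! hf.integrable_smul_right_of_hasCompactSupport ψ.continuous ψ.hasCompactSupport

theorem ofFun_add {f g : ℝ → ℂ} (hf : LocallyIntegrable f) (hg : LocallyIntegrable g) :
    ofFun (f + g) = ofFun f + ofFun g := by
  ext ψ
  rw [add_apply, ofFun_apply hf, ofFun_apply hg, ofFun_apply (hf.add hg),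
    ← integral_add (integrable_mul_test hf ψ) (integrable_mul_test hg ψ)]
  simp only [Pi.add_apply, add_mul]

theorem ofFun_sub {f g : ℝ → ℂ} (hf : LocallyIntegrable f) (hg : LocallyIntegrable g) :
    ofFun (f - g) = ofFun f - ofFun g := by
  ext ψ
  rw [sub_apply, ofFun_apply hf, ofFun_apply hg, ofFun_apply (hf.sub hg),
    ← integral_sub (integrable_mul_test hf ψ) (integrable_mul_test hg ψ)]
  simp only [Pi.sub_apply, sub_mul]

/-- The distribution `ln |x|`, whose derivative enters the second product; `Real.log` is already an
even function. -/
def lnAbs : Distr := ofFun fun x => (Real.log x : ℂ)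

theorem lnPlus_add_lnMinus : lnPlus + lnMinus = lnAbs := by
  rw [lnPlus, lnMinus, ← ofFun_add locallyIntegrable_lnPlusFun locallyIntegrable_lnMinusFun, lnAbs]
  congr 1
  ext x
  rcases lt_trichotomy x 0 with h | rfl | h
  · simp [lnPlusFun, lnMinusFun, h, h.not_gt]
  · simp [lnPlusFun, lnMinusFun]
  · simp [lnPlusFun, lnMinusFun, h, h.not_gt]

theorem lnAbsSgn_eq_ofFun : lnAbsSgn = ofFun (lnPlusFun - lnMinusFun) :=
  (ofFun_sub locallyIntegrable_lnPlusFun locallyIntegrable_lnMinusFun).symm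

theorem xPlusNegSucc_one : xPlusNegSucc 1 = -pd (pd lnPlus) - pd delta := by
  have h : (-1 : ℂ) ^ 1 / (1).factorial = -1 := by simp
  have h' : (-1 : ℂ) ^ 1 * (harmonic 1 : ℂ) / (1).factorial = -1 := by simp [harmonic]
  rw [xPlusNegSucc, h, h']
  ext ψ
  change -1 * pd (pd lnPlus) ψ + -1 * pd delta ψ = -pd (pd lnPlus) ψ - pd delta ψ
  ring

theorem xMinusNegSucc_one : xMinusNegSucc 1 = -pd (pd lnMinus) + pd delta := by
  have h : (-1 : ℂ) / (1).factorial = -1 := by simp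
  have h' : (harmonic 1 : ℂ) / (1).factorial = 1 := by simp [harmonic]
  rw [xMinusNegSucc, h, h']
  ext ψ
  change -1 * pd (pd lnMinus) ψ + 1 * pd delta ψ = -pd (pd lnMinus) ψ + pd delta ψ
  ring

theorem xNegSuccSgn_one : xNegSuccSgn 1 = -pd (pd lnAbsSgn) - (2 : ℂ) • pd delta := by
  rw [xNegSuccSgn, xPlusNegSucc_one, xMinusNegSucc_one, lnAbsSgn, pd_sub, pd_sub]
  norm_num
  module

theorem conv_xNegSuccSgn_mul_theta_add (a : Test) :
    conv (xNegSuccSgn 1) a * conv theta a + conv lnAbsSgn a * conv (pd delta) a =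
      (2 : ℂ) • (conv delta a * conv delta a) +
        (2 : ℂ) • deriv (conv lnAbsSgn a * conv delta a) -
        deriv (deriv (conv lnAbsSgn a * conv theta a)) -
        deriv (deriv (conv theta a * conv theta a)) := by
  rw [deriv_deriv_conv_mul_conv, deriv_deriv_conv_mul_conv, deriv_conv_mul_conv, pd_theta,
    xNegSuccSgn_one, conv_sub, conv_neg, conv_smul]
  ext x
  simp only [Pi.add_apply, Pi.sub_apply, Pi.neg_apply, Pi.mul_apply, Pi.smul_apply,
    Pi.ofNat_apply, smul_eq_mul]
  ring

theorem conv_xPlusNegSucc_mul_theta_sub (a : Test) :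
    conv (xPlusNegSucc 1) a * conv theta a - conv lnMinus a * conv (pd delta) a =
      conv delta a * conv delta a + conv (pd lnAbs) a * conv delta a +
        deriv (conv lnAbsSgn a * conv delta a) -
        deriv (deriv (conv lnPlus a * conv theta a)) -
        (1 / 2 : ℂ) • deriv (deriv (conv theta a * conv theta a)) := by
  rw [deriv_deriv_conv_mul_conv, deriv_deriv_conv_mul_conv, deriv_conv_mul_conv, pd_theta,
    xPlusNegSucc_one, ← lnPlus_add_lnMinus, lnAbsSgn, pd_add, pd_sub, conv_add, conv_sub, conv_sub,
    conv_sub, conv_neg]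
  ext x
  simp only [Pi.add_apply, Pi.sub_apply, Pi.neg_apply, Pi.mul_apply, Pi.smul_apply,
    Pi.ofNat_apply, smul_eq_mul]
  ring

theorem integral_deriv_mul_test {f : ℝ → ℂ} (hf : ContDiff ℝ ∞ f) (ψ : Test) :
    ∫ x, deriv f x * ψ x = -∫ x, f x * dTest ψ x := by
  have hf' : Continuous (deriv f) := hf.continuous_deriv (by simp)
  rw [integral_mul_deriv_eq_deriv_mul_of_integrable
    (fun x _ => (hf.differentiable (by simp) x).hasDerivAt) (fun x _ => hasDerivAt_dTest ψ x)
    (integrable_mul_test hf.continuous.locallyIntegrable (dTest ψ))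
    (integrable_mul_test hf'.locallyIntegrable ψ)
    (integrable_mul_test hf.continuous.locallyIntegrable ψ), neg_neg]

section TendstoDistr

variable {ι : Type*} {F : Filter ι} {f g : ι → ℝ → ℂ} {u v : Distr}

/-- A family `f` of smooth functions tends to the distribution `u` weakly along the filter `F`.
Smoothness is part of the notion so that limits may be differentiated without side conditions. -/
structure TendstoDistr (f : ι → ℝ → ℂ) (F : Filter ι) (u : Distr) : Prop where
  contDiff (i : ι) : ContDiff ℝ ∞ (f i)
  tendsto (ψ : Test) : Tendsto (fun i => ∫ x, f i x * ψ x) F (𝓝 (u ψ))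

namespace TendstoDistr

theorem integrable_mul_test (hf : TendstoDistr f F u) (i : ι) (ψ : Test) :
    Integrable fun x => f i x * ψ x :=
  Colombeau.integrable_mul_test (hf.contDiff i).continuous.locallyIntegrable ψ

theorem add (hf : TendstoDistr f F u) (hg : TendstoDistr g F v) :
    TendstoDistr (fun i => f i + g i) F (u + v) where
  contDiff i := (hf.contDiff i).add (hg.contDiff i)
  tendsto ψ := by
    simpa only [Pi.add_apply, add_mul,
      integral_add (hf.integrable_mul_test _ ψ) (hg.integrable_mul_test _ ψ)]
      using! (hf.tendsto ψ).add (hg.tendsto ψ)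

theorem sub (hf : TendstoDistr f F u) (hg : TendstoDistr g F v) :
    TendstoDistr (fun i => f i - g i) F (u - v) where
  contDiff i := (hf.contDiff i).sub (hg.contDiff i)
  tendsto ψ := by
    simpa only [Pi.sub_apply, sub_mul,
      integral_sub (hf.integrable_mul_test _ ψ) (hg.integrable_mul_test _ ψ)]
      using! (hf.tendsto ψ).sub (hg.tendsto ψ)

theorem const_smul (c : ℂ) (hf : TendstoDistr f F u) :
    TendstoDistr (fun i => c • f i) F (c • u) where
  contDiff i := contDiff_const.smul (hf.contDiff i)
  tendsto ψ := by
    simpa only [Pi.smul_apply, smul_eq_mul, mul_assoc, integral_const_mul]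
      using! (hf.tendsto ψ).const_mul c

theorem deriv (hf : TendstoDistr f F u) : TendstoDistr (fun i => deriv (f i)) F (pd u) where
  contDiff i := (contDiff_infty_iff_deriv.mp (hf.contDiff i)).2
  tendsto ψ := by
    simpa only [integral_deriv_mul_test (hf.contDiff _)] using! (hf.tendsto (dTest ψ)).neg

end TendstoDistr

end TendstoDistr

theorem conv_ofFun {f : ℝ → ℂ} (hf : LocallyIntegrable f) (a : Test) (x : ℝ) :
    conv (ofFun f) a x = ∫ y, f y * a (x - y) := by
  rw [conv, ofFun_apply hf]
  rfl

theorem conv_ofFun_eq_convolution {f : ℝ → ℂ} (hf : LocallyIntegrable f) (a : Test) :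
    conv (ofFun f) a = f ⋆[ContinuousLinearMap.mul ℝ ℂ, volume] a :=
  funext (conv_ofFun hf a)

theorem conv_ofFun_eq_integral_sub {f : ℝ → ℂ} (hf : LocallyIntegrable f) (a : Test) (x : ℝ) :
    conv (ofFun f) a x = ∫ y, f (x - y) * a y := by
  rw [conv_ofFun_eq_convolution hf, convolution_eq_swap]
  rfl

theorem integral_conv_mul {f w : ℝ → ℂ} (hf : LocallyIntegrable f) (a : Test)
    (hw : Continuous w) (hc : HasCompactSupport w) :
    ∫ x, conv (ofFun f) a x * w x = ∫ y, f y * ∫ z, w (y + z) * a z := by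
  set k : ℝ → ℂ := fun x => w (-x)
  have hk : Continuous k := hw.comp continuous_neg
  have hkc : HasCompactSupport k := hc.comp_homeomorph (Homeomorph.neg ℝ)
  let L := ContinuousLinearMap.mul ℝ ℂ
  have hassoc : ((f ⋆[L, volume] a) ⋆[L, volume] k) 0 = (f ⋆[L, volume] (a ⋆[L, volume] k)) 0 :=
    convolution_assoc L L L L mul_assoc hf.aestronglyMeasurable a.continuous.aestronglyMeasurable
      hk.aestronglyMeasurable
      (Eventually.of_forall (a.hasCompactSupport.convolutionExists_right L hf a.continuous))
      (Eventually.of_forall (hkc.norm.convolutionExists_right _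
        a.continuous.norm.locallyIntegrable hk.norm))
      ((a.hasCompactSupport.norm.convolution _ hkc.norm).convolutionExists_right _
        (fun x => (hf x).norm)
        (hkc.norm.continuous_convolution_right _ a.continuous.norm.locallyIntegrable hk.norm) 0)
  rw [← conv_ofFun_eq_convolution hf] at hassoc
  simpa only [convolution_def, L, k, ContinuousLinearMap.mul_apply', zero_sub, neg_neg, neg_sub,
    sub_neg_eq_add, mul_comm (a _), add_comm] using hassoc

theorem integral_conv_mul_reflect {f : ℝ → ℂ} (hf : LocallyIntegrable f) (a b : Test) :
    ∫ x, conv (ofFun f) a x * b x = ∫ y, f (-y) * ∫ z, a (y + z) * b z := by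
  rw [integral_conv_mul hf a b.continuous b.hasCompactSupport, ← integral_neg_eq_self]
  congr 1
  ext y
  rw [← integral_add_left_eq_self _ y]
  simp [mul_comm]

theorem integrable_test (a : Test) : Integrable a :=
  a.continuous.integrable_of_hasCompactSupport a.hasCompactSupport

theorem locallyIntegrable_mul_of_norm_le {f g : ℝ → ℂ} (hf : LocallyIntegrable f)
    (hg : AEStronglyMeasurable g) {M : ℝ} (hM : ∀ x, ‖g x‖ ≤ M) : LocallyIntegrable (f * g) :=
  fun x =>
    let ⟨s, hs, hfs⟩ := hf x
    ⟨s, hs, hfs.mul_bdd hg.restrict (Eventually.of_forall hM)⟩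

section IsDeltaNet

variable {ι κ : Type*} {F : Filter ι} {d : ι → Test}

/-- A strict delta net along the filter `F`: test functions with integral one and bounded `L¹` norm
whose supports shrink to the origin. -/
structure IsDeltaNet (d : ι → Test) (F : Filter ι) : Prop where
  integral_eq_one : ∀ᶠ i in F, ∫ x, d i x = 1
  integral_norm_le : ∃ C, ∀ᶠ i in F, ∫ x, ‖d i x‖ ≤ C
  support_subset : ∀ r > 0, ∀ᶠ i in F, ∀ x, r ≤ |x| → d i x = 0

theorem norm_integral_mul_le {h : ℝ → ℂ} {B : ℝ} (a : Test) (hB : ∀ x, a x ≠ 0 → ‖h x‖ ≤ B) :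
    ‖∫ x, h x * a x‖ ≤ B * ∫ x, ‖a x‖ := by
  rw [← integral_const_mul]
  refine norm_integral_le_of_norm_le ((integrable_test a).norm.const_mul B)
    (Eventually.of_forall fun x => ?_)
  rw [norm_mul]
  by_cases hx : a x = 0
  · simp [hx]
  · exact mul_le_mul_of_nonneg_right (hB x hx) (norm_nonneg _)

theorem norm_conv_ofFun_le_integral_norm {g : ℝ → ℂ} (hg : LocallyIntegrable g) {M : ℝ}
    (hM : ∀ x, ‖g x‖ ≤ M) (a : Test) (x : ℝ) :
    ‖conv (ofFun g) a x‖ ≤ M * ∫ y, ‖a y‖ := by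
  rw [conv_ofFun_eq_integral_sub hg]
  exact norm_integral_mul_le a fun y _ => hM (x - y)

theorem norm_integral_conv_mul_comp_add_le {g w : ℝ → ℂ} (hg : LocallyIntegrable g) {M B : ℝ}
    (hM : ∀ x, ‖g x‖ ≤ M) (hB : ∀ x, ‖w x‖ ≤ B) (a : Test) (y : ℝ) :
    ‖∫ z, conv (ofFun g) a (y + z) * w (y + z) * a z‖ ≤ M * B * (∫ x, ‖a x‖) ^ 2 := by
  refine (norm_integral_mul_le (h := fun z => conv (ofFun g) a (y + z) * w (y + z)) a
    (B := M * (∫ x, ‖a x‖) * B) fun z _ => ?_).trans_eq (by ring)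
  rw [norm_mul]
  have hconv := norm_conv_ofFun_le_integral_norm hg hM a (y + z)
  exact mul_le_mul hconv (hB _) (norm_nonneg _) ((norm_nonneg _).trans hconv)

theorem integral_comp_add_mul_eq_zero {w a : ℝ → ℂ} {R r y : ℝ} (hw : ∀ x, R < |x| → w x = 0)
    (ha : ∀ z, r ≤ |z| → a z = 0) (hy : R + r < |y|) : ∫ z, w (y + z) * a z = 0 := by
  refine integral_eq_zero_of_ae (Eventually.of_forall fun z => ?_)
  rcases le_or_gt r |z| with hz | hz
  · simp [ha z hz]
  · have hyz : |y| ≤ |y + z| + |z| := by simpa using abs_sub (y + z) z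
    simp [hw (y + z) (by linarith)]

namespace IsDeltaNet

theorem comp {k : κ → ι} {F' : Filter κ} (hd : IsDeltaNet d F) (hk : Tendsto k F' F) :
    IsDeltaNet (d ∘ k) F' where
  integral_eq_one := hk.eventually hd.integral_eq_one
  integral_norm_le := hd.integral_norm_le.imp fun _ h => hk.eventually h
  support_subset r hr := hk.eventually (hd.support_subset r hr)

theorem tendsto_integral_mul (hd : IsDeltaNet d F) {h : ι → ℝ → ℂ} {c : ℂ}
    (hi : ∀ i, Integrable fun x => h i x * d i x)
    (hc : Tendsto (Function.uncurry h) (F ×ˢ 𝓝 0) (𝓝 c)) :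
    Tendsto (fun i => ∫ x, h i x * d i x) F (𝓝 c) := by
  obtain ⟨C, hC⟩ := hd.integral_norm_le
  rw [Metric.tendsto_nhds]
  intro ε hε
  have hC' : 0 < |C| + 1 := by positivity
  obtain ⟨p, hp, q, hq, hpq⟩ := eventually_prod_iff.mp
    (Metric.tendsto_nhds.mp hc (ε / (|C| + 1)) (by positivity))
  obtain ⟨r, hr, hrq⟩ := Metric.eventually_nhds_iff.mp hq
  filter_upwards [hp, hC, hd.integral_eq_one, hd.support_subset r hr] with i hpi hCi h1 hs
  have hsub : (∫ x, h i x * d i x) - c = ∫ x, (h i x - c) * d i x := by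
    simp only [sub_mul]
    rw [integral_sub (hi i) ((integrable_test (d i)).const_mul c),
      integral_const_mul, h1, mul_one]
  rw [dist_eq_norm, hsub]
  calc ‖∫ x, (h i x - c) * d i x‖ ≤ ε / (|C| + 1) * ∫ x, ‖d i x‖ := by
        refine norm_integral_mul_le (d i) fun x hx => ?_
        rw [← dist_eq_norm]
        refine (hpq hpi (hrq ?_)).le
        rw [Real.dist_0_eq_abs]
        exact not_le.mp (mt (hs x) hx)
    _ ≤ ε / (|C| + 1) * |C| := by gcongr; exact hCi.trans (le_abs_self C)
    _ < ε / (|C| + 1) * (|C| + 1) := by gcongr; exact lt_add_one _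
    _ = ε := div_mul_cancel₀ ε hC'.ne'

theorem tendsto_conv_ofFun (hd : IsDeltaNet d F) {g : ℝ → ℂ} (hg : LocallyIntegrable g) {y : ℝ}
    (hy : ContinuousAt g y) :
    Tendsto (fun p : ι × ℝ => conv (ofFun g) (d p.1) p.2) (F ×ˢ 𝓝 y) (𝓝 (g y)) := by
  simp only [conv_ofFun_eq_integral_sub hg]
  refine (hd.comp tendsto_fst).tendsto_integral_mul (h := fun (p : ι × ℝ) z => g (p.2 - z))
    (fun p => ?_) ?_
  · simpa only [reflTranslate_apply, sub_sub_cancel]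
      using! (integrable_mul_test hg (reflTranslate p.2 (d p.1))).comp_sub_left p.2
  · refine hy.tendsto.comp ?_
    have hy' : Tendsto (fun q : (ι × ℝ) × ℝ => q.1.2) ((F ×ˢ 𝓝 y) ×ˢ 𝓝 0) (𝓝 y) :=
      tendsto_snd.comp tendsto_fst
    simpa only [sub_zero] using! hy'.sub tendsto_snd

theorem tendsto_integral_conv_mul_comp_add (hd : IsDeltaNet d F) {g : ℝ → ℂ}
    (hg : LocallyIntegrable g) (ψ : Test) {y : ℝ} (hy : ContinuousAt g y) :
    Tendsto (fun i => ∫ z, conv (ofFun g) (d i) (y + z) * ψ (y + z) * d i z) F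
      (𝓝 (g y * ψ y)) := by
  have hadd : Tendsto (fun z => y + z) (𝓝 0) (𝓝 y) := by
    simpa only [add_zero] using! (tendsto_id (α := ℝ) (x := 𝓝 0)).const_add y
  refine hd.tendsto_integral_mul (h := fun i z => conv (ofFun g) (d i) (y + z) * ψ (y + z))
    (fun i => integrable_mul_test (Continuous.locallyIntegrable (by fun_prop)) (d i)) ?_
  exact ((hd.tendsto_conv_ofFun hg hy).comp (tendsto_id.prodMap hadd)).mul
    ((ψ.continuous.tendsto y).comp (hadd.comp tendsto_snd))

theorem tendstoDistr_conv_mul_conv [F.IsCountablyGenerated] (hd : IsDeltaNet d F) {f g : ℝ → ℂ}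
    (hf : LocallyIntegrable f) (hg : LocallyIntegrable g) {M : ℝ} (hM : ∀ x, ‖g x‖ ≤ M)
    (hgc : ∀ᵐ y, ContinuousAt g y) :
    TendstoDistr (fun i => conv (ofFun f) (d i) * conv (ofFun g) (d i)) F (ofFun (f * g)) where
  contDiff i := (contDiff_conv _ _).mul (contDiff_conv _ _)
  tendsto ψ := by
    obtain ⟨C, hC⟩ := hd.integral_norm_le
    obtain ⟨R, hR⟩ := exists_support_bound ψ
    obtain ⟨B, hB⟩ := exists_iteratedDeriv_bound ψ 0
    simp only [iteratedDeriv_zero] at hB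
    have hM0 : 0 ≤ M := (norm_nonneg _).trans (hM 0)
    have hB0 : 0 ≤ B := (norm_nonneg _).trans (hB 0)
    have hpair (i : ι) : ∫ x, (conv (ofFun f) (d i) * conv (ofFun g) (d i)) x * ψ x =
        ∫ y, f y * ∫ z, conv (ofFun g) (d i) (y + z) * ψ (y + z) * d i z := by
      rw [← integral_conv_mul hf (d i) (w := fun x => conv (ofFun g) (d i) x * ψ x)
        (by fun_prop) ψ.hasCompactSupport.mul_left]
      simp only [Pi.mul_apply, mul_assoc]
    have hfg := locallyIntegrable_mul_of_norm_le hf hg.aestronglyMeasurable hM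
    simp_rw [hpair, ofFun_apply hfg, Pi.mul_apply, mul_assoc (f _)]
    set K := Icc (-(R + 1)) (R + 1)
    have hKf : Integrable (K.indicator fun y => ‖f y‖ * (M * B * C ^ 2)) :=
      IntegrableOn.integrable_indicator
        ((hf.integrableOn_isCompact isCompact_Icc).norm.mul_const _) measurableSet_Icc
    refine tendsto_integral_filter_of_dominated_convergence _ ?_ ?_ hKf ?_
    · refine Eventually.of_forall fun i => hf.aestronglyMeasurable.mul ?_
      exact (StronglyMeasurable.integral_prod_right (Continuous.stronglyMeasurable
        (by unfold Function.uncurry; fun_prop))).aestronglyMeasurable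
    · filter_upwards [hC, hd.support_subset 1 one_pos] with i hi hs
      refine Eventually.of_forall fun y => ?_
      by_cases hy : y ∈ K
      · rw [indicator_of_mem hy, norm_mul]
        gcongr
        refine (norm_integral_conv_mul_comp_add_le hg hM hB (d i) y).trans ?_
        gcongr
      · rw [indicator_of_notMem hy, integral_comp_add_mul_eq_zero
          (w := fun x => conv (ofFun g) (d i) x * ψ x) (fun x hx => by rw [hR x hx, mul_zero]) hs
          (not_le.mp fun h => hy (abs_le.mp h)), mul_zero, norm_zero]
    · filter_upwards [hgc] with y hy
      exact (hd.tendsto_integral_conv_mul_comp_add hg ψ hy).const_mul (f y)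

end IsDeltaNet
end IsDeltaNet

theorem norm_test_sub_taylor_le (ψ : Test) :
    ∃ M, ∀ x : ℝ, ‖ψ x - (ψ 0 + x * dTest ψ 0)‖ ≤ M * x ^ 2 := by
  obtain ⟨M, hM⟩ := exists_iteratedDeriv_bound ψ 2
  refine ⟨M, fun x => ?_⟩
  have h := taylor_bound ψ.contDiff
    (fun z => by rw [← iteratedDeriv_one, ← iteratedDeriv_succ']; exact hM z) 0 x
  simpa only [zero_add, sq_abs, Complex.real_smul, sub_sub, dTest_apply] using h

theorem TendstoDistr.of_moments {ι : Type*} {F : Filter ι} {f : ι → ℝ → ℂ} {m₀ m₁ : ℂ}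
    (hf : ∀ i, ContDiff ℝ ∞ (f i)) (hc : ∀ i, HasCompactSupport (f i))
    (h₀ : Tendsto (fun i => ∫ x, f i x) F (𝓝 m₀))
    (h₁ : Tendsto (fun i => ∫ x : ℝ, f i x * x) F (𝓝 m₁))
    (h₂ : Tendsto (fun i => ∫ x, |x| ^ 2 * ‖f i x‖) F (𝓝 0)) :
    TendstoDistr f F (m₀ • delta - m₁ • pd delta) where
  contDiff := hf
  tendsto ψ := by
    obtain ⟨M, hM⟩ := norm_test_sub_taylor_le ψ
    have hint {w : ℝ → ℂ} (hw : Continuous w) (i : ι) : Integrable fun x => f i x * w x :=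
      ((hf i).continuous.mul hw).integrable_of_hasCompactSupport (hc i).mul_right
    have hsplit (i : ι) : ∫ x, f i x * ψ x = (∫ x, f i x) * ψ 0 + (∫ x : ℝ, f i x * x) * dTest ψ 0
        + ∫ x, f i x * (ψ x - (ψ 0 + x * dTest ψ 0)) := by
      rw [← integral_mul_const, ← integral_mul_const, ← integral_add, ← integral_add]
      · congr with x
        ring
      · simpa only [mul_add, mul_assoc] using! hint (w := fun x => ψ 0 + x * dTest ψ 0)
          (by fun_prop) i
      · exact hint (by fun_prop) i
      · exact hint continuous_const i
      · simpa only [mul_assoc] using! hint (w := fun x => x * dTest ψ 0) (by fun_prop) i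
    have hrem : Tendsto (fun i => ∫ x, f i x * (ψ x - (ψ 0 + x * dTest ψ 0))) F (𝓝 0) := by
      refine squeeze_zero_norm (fun i => ?_) (by simpa only [mul_zero] using h₂.const_mul M)
      rw [← integral_const_mul]
      refine norm_integral_le_of_norm_le (Continuous.integrable_of_hasCompactSupport
        (by have := (hf i).continuous; fun_prop) ((hc i).norm.mul_left.mul_left))
        (Eventually.of_forall fun x => ?_)
      rw [norm_mul, mul_comm, ← mul_assoc, sq_abs]
      exact mul_le_mul_of_nonneg_right (hM x) (norm_nonneg _)
    simp_rw [hsplit]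
    convert ((h₀.mul_const (ψ 0)).add (h₁.mul_const (dTest ψ 0))).add hrem using 2
    change m₀ * ψ 0 - m₁ * -dTest ψ 0 = _
    ring

theorem integral_eq_zero_of_odd {f : ℝ → ℂ} (hf : f.Odd) : ∫ x, f x = 0 := by
  have h := integral_neg_eq_self f volume
  rw [funext hf, integral_neg] at h
  exact CharZero.eq_neg_self_iff.mp h.symm

theorem integral_conv_mul_of_even {f : ℝ → ℂ} (hf : LocallyIntegrable f) (he : f.Even)
    (a b : Test) : ∫ x, conv (ofFun f) a x * b x = ∫ x, conv (ofFun f) b x * a x := by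
  rw [integral_conv_mul hf a b.continuous b.hasCompactSupport, integral_conv_mul_reflect hf b a]
  simp only [he _]

theorem integral_conv_mul_of_odd {f : ℝ → ℂ} (hf : LocallyIntegrable f) (ho : f.Odd)
    (a b : Test) : ∫ x, conv (ofFun f) a x * b x = -∫ x, conv (ofFun f) b x * a x := by
  rw [integral_conv_mul hf a b.continuous b.hasCompactSupport, integral_conv_mul_reflect hf b a,
    ← integral_neg]
  simp only [ho _, neg_mul, neg_neg]

theorem integral_conv_pd_mul_of_even {f : ℝ → ℂ} (hf : LocallyIntegrable f) (he : f.Even)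
    (a b : Test) :
    ∫ x, conv (pd (ofFun f)) a x * b x = -∫ x, conv (pd (ofFun f)) b x * a x := by
  rw [conv_pd, integral_conv_mul_of_even hf he, ← deriv_conv,
    integral_deriv_mul_test (contDiff_conv _ _), neg_neg]

theorem integral_conv_mul_self_of_odd {f : ℝ → ℂ} (hf : LocallyIntegrable f) (ho : f.Odd)
    (a : Test) : ∫ x, conv (ofFun f) a x * a x = 0 :=
  CharZero.eq_neg_self_iff.mp (integral_conv_mul_of_odd hf ho a a)

theorem integral_conv_pd_mul_self_of_even {f : ℝ → ℂ} (hf : LocallyIntegrable f) (he : f.Even)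
    (a : Test) : ∫ x, conv (pd (ofFun f)) a x * a x = 0 :=
  CharZero.eq_neg_self_iff.mp (integral_conv_pd_mul_of_even hf he a a)

/-- The test function `x ↦ x * a x`, pairing with which gives first moments against `a`. -/
def mulId (a : Test) : Test where
  toFun x := x * a x
  contDiff' := Complex.ofRealCLM.contDiff.mul a.contDiff
  hasCompactSupport' := a.hasCompactSupport.mul_left
  tsupport_subset' := by simp

@[simp] theorem mulId_apply (a : Test) (x : ℝ) : mulId a x = x * a x := rfl

theorem dTest_mulId (a : Test) (x : ℝ) : dTest (mulId a) x = a x + x * dTest a x := by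
  have h : HasDerivAt (mulId a) (1 * a x + x * dTest a x) x :=
    (hasDerivAt_id x).ofReal_comp.mul (hasDerivAt_dTest a x)
  rw [dTest_apply, h.deriv, one_mul]

theorem mulId_reflTranslate (x : ℝ) (a : Test) :
    mulId (reflTranslate x a) = (x : ℂ) • reflTranslate x a - reflTranslate x (mulId a) := by
  ext y
  change (y : ℂ) * a (x - y) = x * a (x - y) - (x - y : ℝ) * a (x - y)
  push_cast
  ring

theorem integral_eq_zero_of_hasDerivAt_off_countable {E : Type*} [NormedAddCommGroup E]
    [NormedSpace ℝ E] [CompleteSpace E] {f f' : ℝ → E} {s : Set ℝ} (hs : s.Countable)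
    (hf : Continuous f) (hd : ∀ x ∉ s, HasDerivAt f (f' x) x) (hi : Integrable f')
    (h₀ : Tendsto f (cocompact ℝ) (𝓝 0)) : ∫ x, f' x = 0 := by
  have hFTC (S : ℝ) : ∫ x in -S..S, f' x = f S - f (-S) :=
    integral_eq_of_hasDerivAt_off_countable f f' hs hf.continuousOn (fun x hx => hd x hx.2)
      hi.intervalIntegrable
  have hlim := intervalIntegral_tendsto_integral hi tendsto_neg_atTop_atBot tendsto_id
  simp only [id, hFTC] at hlim
  refine tendsto_nhds_unique hlim ?_
  simpa only [sub_zero] using! (h₀.mono_left atTop_le_cocompact).sub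
    ((h₀.mono_left atBot_le_cocompact).comp tendsto_neg_atTop_atBot)

theorem pd_lnAbs_mulId (a : Test) : pd lnAbs (mulId a) = ∫ x, a x := by
  have hlog : Integrable fun x => (Real.log x : ℂ) * dTest (mulId a) x :=
    integrable_mul_test locallyIntegrable_log _
  have hd : ∀ x ∉ ({0} : Set ℝ), HasDerivAt (fun x : ℝ => ((x * Real.log x : ℝ) : ℂ) * a x)
      (Real.log x * dTest (mulId a) x + a x) x := by
    intro x hx
    refine ((Real.hasDerivAt_mul_log hx).ofReal_comp.mul (hasDerivAt_dTest a x)).congr_deriv ?_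
    rw [dTest_mulId]
    push_cast
    ring
  have hcont : Continuous fun x : ℝ => ((x * Real.log x : ℝ) : ℂ) * a x :=
    (Complex.continuous_ofReal.comp Real.continuous_mul_log).mul a.continuous
  have h := integral_eq_zero_of_hasDerivAt_off_countable (countable_singleton 0) hcont hd
    (hlog.add (integrable_test a)) a.hasCompactSupport.mul_left.is_zero_at_infty
  rw [integral_add hlog (integrable_test a)] at h
  rw [pd_apply, lnAbs, ofFun_apply locallyIntegrable_log]
  exact neg_eq_of_add_eq_zero_right h

theorem mul_conv_pd_lnAbs (a : Test) (x : ℝ) :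
    x * conv (pd lnAbs) a x = conv (pd lnAbs) (mulId a) x + ∫ y, a y := by
  have h := pd_lnAbs_mulId (reflTranslate x a)
  rw [mulId_reflTranslate, map_sub, map_smul, smul_eq_mul, sub_eq_iff_eq_add'] at h
  rw [← integral_sub_left_eq_self a volume x]
  exact h

/-- Multiplication by `x` turns the antisymmetry of convolution with `∂ ln|x|` into a symmetry up
to the constant `x * ∂ ln|x| = 1`, so the first moment is half of what that constant contributes. -/
theorem integral_conv_pd_lnAbs_mul_self_mul_id {a : Test} (ha : ∫ x, a x = 1) :
    ∫ x, conv (pd lnAbs) a x * a x * x = 1 / 2 := by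
  have hanti : ∫ x, conv (pd lnAbs) a x * mulId a x = -∫ x, conv (pd lnAbs) (mulId a) x * a x :=
    integral_conv_pd_mul_of_even locallyIntegrable_log (fun x => by simp) a _
  have hconst : ∫ x, conv (pd lnAbs) a x * mulId a x =
      (∫ x, conv (pd lnAbs) (mulId a) x * a x) + 1 := by
    rw [← ha, ← integral_add (integrable_mul_test (continuous_conv _ _).locallyIntegrable a)
      (integrable_test a)]
    congr with x
    rw [mulId_apply]
    linear_combination a x * (mul_conv_pd_lnAbs a x).trans (by rw [ha])
  have hswap : ∫ x, conv (pd lnAbs) a x * a x * x = ∫ x, conv (pd lnAbs) a x * mulId a x := by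
    simp only [mulId_apply, mul_assoc, mul_comm (a _)]
  linear_combination hswap + (hanti + hconst) / 2

theorem integral_le_of_support {g : ℝ → ℝ} {r B : ℝ} (hr : 0 ≤ r) (hs : ∀ x, r < |x| → g x = 0)
    (hB : ∀ x, |x| ≤ r → ‖g x‖ ≤ B) : ∫ x, g x ≤ B * (2 * r) := by
  rw [← setIntegral_eq_integral_of_forall_compl_eq_zero (s := Icc (-r) r)
    fun x hx => hs x (not_le.mp fun h => hx (abs_le.mp h))]
  refine (le_abs_self _).trans ((norm_setIntegral_le_of_norm_le_const (s := Icc (-r) r) (by simp)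
    fun x hx => hB x (abs_le.mpr hx)).trans_eq ?_)
  rw [Real.volume_real_Icc_of_le (by linarith)]
  ring

theorem norm_conv_ofFun_le {f : ℝ → ℂ} (hf : LocallyIntegrable f) {a : Test} {r B x : ℝ}
    (hs : ∀ x, r < |x| → a x = 0) (hB : ∀ x, ‖a x‖ ≤ B) (hx : |x| ≤ r) :
    ‖conv (ofFun f) a x‖ ≤ B * ∫ y in -(2 * r)..2 * r, ‖f y‖ := by
  have hr : 0 ≤ r := (abs_nonneg x).trans hx
  have hfi : IntegrableOn (fun y => B * ‖f y‖) (Icc (-(2 * r)) (2 * r)) :=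
    (hf.integrableOn_isCompact isCompact_Icc).norm.const_mul B
  rw [conv_ofFun hf, ← intervalIntegral.integral_const_mul,
    intervalIntegral.integral_of_le (by linarith), ← integral_Icc_eq_integral_Ioc,
    ← integral_indicator measurableSet_Icc]
  refine norm_integral_le_of_norm_le (hfi.integrable_indicator measurableSet_Icc)
    (Eventually.of_forall fun y => ?_)
  by_cases hy : y ∈ Icc (-(2 * r)) (2 * r)
  · rw [indicator_of_mem hy, norm_mul, mul_comm]
    exact mul_le_mul_of_nonneg_right (hB _) (norm_nonneg _)
  · have hxy : r < |x - y| := by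
      have h1 := not_le.mp (mt abs_le.mp hy)
      have h2 := abs_sub_abs_le_abs_sub y x
      rw [abs_sub_comm] at h2
      linarith
    rw [indicator_of_notMem hy, hs _ hxy, mul_zero, norm_zero]

theorem tendsto_intervalIntegral_neg_self {E : Type*} [NormedAddCommGroup E] [NormedSpace ℝ E]
    {g : ℝ → E} (hg : LocallyIntegrable g) :
    Tendsto (fun r => ∫ y in -r..r, g y) (𝓝 0) (𝓝 0) := by
  have hi (a b : ℝ) : IntervalIntegrable g volume a b :=
    (hg.integrableOn_isCompact isCompact_uIcc).intervalIntegrable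
  have hc : Continuous fun r => ∫ y in 0..r, g y := intervalIntegral.continuous_primitive hi 0
  have hsub (r : ℝ) : ∫ y in -r..r, g y = (∫ y in 0..r, g y) - ∫ y in 0..-r, g y :=
    (intervalIntegral.integral_interval_sub_left (hi _ _) (hi _ _)).symm
  simpa [hsub] using! (hc.sub (hc.comp continuous_neg)).tendsto 0

theorem tendsto_const_mul_nhdsGT_zero (c : ℝ) : Tendsto (fun σ => c * σ) (𝓝[>] 0) (𝓝 0) :=
  ((continuous_const_mul c).tendsto' 0 0 (mul_zero c)).mono_left nhdsWithin_le_nhds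

theorem dTest_iterate_eq_zero {a : Test} {r : ℝ} (ha : ∀ x, r < |x| → a x = 0) (k : ℕ) :
    ∀ x, r < |x| → dTest^[k] a x = 0 := by
  induction k with
  | zero => exact ha
  | succ k ih =>
    intro x hx
    have h : dTest^[k] a =ᶠ[𝓝 x] fun _ => 0 :=
      ((isOpen_lt continuous_const continuous_abs).eventually_mem hx).mono ih
    rw [Function.iterate_succ_apply', dTest_apply, h.deriv_eq, deriv_const]

namespace DeltaFamily

variable (D : DeltaFamily)

theorem net_even {σ : ℝ} (hσ : 0 < σ) : Function.Even (D.net σ) := fun x => by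
  simp only [net, dilate_apply, mul_neg, D.even σ hσ]

theorem integral_net {σ : ℝ} (hσ : 0 < σ) : ∫ x, D.net σ x = 1 := by
  have hσ' : (σ : ℂ) ≠ 0 := mod_cast hσ.ne'
  simp only [net, dilate_apply]
  rw [integral_const_mul, Measure.integral_comp_mul_left (D.toFun σ), D.integral_eq_one σ hσ,
    inv_inv, abs_of_pos hσ]
  simp [hσ']

theorem integral_net_sq {σ : ℝ} (hσ : 0 < σ) : ∫ x, D.net σ x * D.net σ x = 1 := by
  have hσ' : (σ : ℂ) ≠ 0 := mod_cast hσ.ne'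
  have hsq (x : ℝ) : D.net σ x * D.net σ x = ((σ : ℂ)⁻¹) ^ 2 * D.toFun σ (σ⁻¹ * x) ^ 2 := by
    rw [net, dilate_apply]
    ring
  simp only [hsq]
  rw [integral_const_mul, Measure.integral_comp_mul_left (fun x => D.toFun σ x ^ 2), inv_inv,
    abs_of_pos hσ, Complex.real_smul, ← D.integral_sq σ hσ]
  field_simp

theorem exists_net_support :
    ∃ l > 0, ∀ᶠ σ in 𝓝[>] (0 : ℝ), ∀ x, l * σ < |x| → D.net σ x = 0 := by
  obtain ⟨l, hl⟩ := D.support_bound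
  refine ⟨|l| + 1, by positivity, ?_⟩
  filter_upwards [self_mem_nhdsWithin, hl] with σ (hσ : 0 < σ) hl x hx
  rw [net, dilate_apply, hl, mul_zero]
  rw [abs_mul, abs_of_pos (inv_pos.mpr hσ), lt_inv_mul_iff₀ hσ]
  nlinarith [le_abs_self l]

theorem exists_norm_iterate_dTest_net_le (k : ℕ) :
    ∃ C, ∀ᶠ σ in 𝓝[>] (0 : ℝ), ∀ x, ‖dTest^[k] (D.net σ) x‖ ≤ C / σ ^ (k + 1) := by
  obtain ⟨C, hC⟩ := D.deriv_bound k
  refine ⟨C, ?_⟩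
  filter_upwards [self_mem_nhdsWithin, hC] with σ (hσ : 0 < σ) hC x
  rw [coe_dTest_iterate, net, iteratedDeriv_dilate, norm_mul, norm_pow, norm_inv,
    Complex.norm_real, Real.norm_of_nonneg hσ.le, inv_pow, div_eq_inv_mul]
  exact mul_le_mul_of_nonneg_left (hC _) (by positivity)

theorem isDeltaNet_net : IsDeltaNet D.net (𝓝[>] 0) where
  integral_eq_one := eventually_mem_nhdsWithin.mono fun _ hσ => D.integral_net hσ
  integral_norm_le := by
    obtain ⟨l, hl, hs⟩ := D.exists_net_support
    obtain ⟨C, hC⟩ := D.exists_norm_iterate_dTest_net_le 0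
    refine ⟨2 * l * C, ?_⟩
    filter_upwards [self_mem_nhdsWithin, hs, hC] with σ (hσ : 0 < σ) hs hC
    refine (integral_le_of_support (r := l * σ) (B := C / σ) (by positivity)
      (fun x hx => by rw [hs x hx, norm_zero]) fun x _ => ?_).trans_eq ?_
    · simpa using hC x
    · field_simp
  support_subset r hr := by
    obtain ⟨l, -, hs⟩ := D.exists_net_support
    filter_upwards [hs, (tendsto_const_mul_nhdsGT_zero l).eventually_lt_const hr]
      with σ hs hlr x hx using hs x (hlr.trans_le hx)

theorem integral_abs_pow_mul_norm_conv_le {f : ℝ → ℂ} (hf : LocallyIntegrable f) (k j : ℕ) :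
    ∃ l B, ∀ᶠ σ in 𝓝[>] (0 : ℝ),
      ∫ x, |x| ^ (k + j + 1) * ‖conv (ofFun f) (dTest^[k] (D.net σ)) x * D.net σ x‖ ≤
        B * σ ^ j * ∫ y in -(l * σ)..l * σ, ‖f y‖ := by
  obtain ⟨l, hl, hs⟩ := D.exists_net_support
  obtain ⟨C₀, hC₀⟩ := D.exists_norm_iterate_dTest_net_le 0
  obtain ⟨C, hC⟩ := D.exists_norm_iterate_dTest_net_le k
  refine ⟨2 * l, 2 * l ^ (k + j + 2) * C * C₀, ?_⟩
  filter_upwards [self_mem_nhdsWithin, hs, hC₀, hC] with σ (hσ : 0 < σ) hs hC₀ hC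
  set I := ∫ y in -(2 * (l * σ))..2 * (l * σ), ‖f y‖
  have hpt (x : ℝ) (hx : |x| ≤ l * σ) :
      ‖|x| ^ (k + j + 1) * ‖conv (ofFun f) (dTest^[k] (D.net σ)) x * D.net σ x‖‖ ≤
        (l * σ) ^ (k + j + 1) * (C / σ ^ (k + 1) * I * (C₀ / σ)) := by
    have hconv := norm_conv_ofFun_le hf (dTest_iterate_eq_zero hs k) hC hx
    rw [Real.norm_of_nonneg (by positivity), norm_mul]
    gcongr
    · exact (norm_nonneg _).trans hconv
    · simpa using hC₀ x
  refine (integral_le_of_support (by positivity)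
    (fun x hx => by rw [hs x hx, mul_zero, norm_zero, mul_zero]) hpt).trans_eq ?_
  rw [mul_assoc 2 l σ]
  change _ = _ * I
  field_simp
  ring

theorem tendsto_integral_abs_pow_mul_norm_conv {f : ℝ → ℂ} (hf : LocallyIntegrable f) {k m : ℕ}
    (hkm : k < m) :
    Tendsto (fun σ => ∫ x, |x| ^ m * ‖conv (ofFun f) (dTest^[k] (D.net σ)) x * D.net σ x‖)
      (𝓝[>] 0) (𝓝 0) := by
  obtain ⟨j, rfl⟩ := Nat.exists_eq_add_of_lt hkm
  obtain ⟨l, B, hB⟩ := D.integral_abs_pow_mul_norm_conv_le hf k j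
  have hf' : LocallyIntegrable fun y => ‖f y‖ := fun x => (hf x).norm
  have hI := (tendsto_intervalIntegral_neg_self hf').comp (tendsto_const_mul_nhdsGT_zero l)
  have hpow : Tendsto (fun σ : ℝ => B * σ ^ j) (𝓝[>] 0) (𝓝 (B * 0 ^ j)) :=
    (Continuous.tendsto (by fun_prop) 0).mono_left nhdsWithin_le_nhds
  exact squeeze_zero' (Eventually.of_forall fun σ => integral_nonneg fun x => by positivity) hB
    (by simpa only [mul_zero] using! hpow.mul hI)

theorem tendsto_integral_sq_mul_norm_conv_pd {f : ℝ → ℂ} (hf : LocallyIntegrable f) :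
    Tendsto (fun σ => ∫ x, |x| ^ 2 * ‖conv (pd (ofFun f)) (D.net σ) x * D.net σ x‖)
      (𝓝[>] 0) (𝓝 0) := by
  simpa only [conv_pd, Function.iterate_one] using
    D.tendsto_integral_abs_pow_mul_norm_conv hf one_lt_two

theorem tendstoDistr_delta_sq :
    TendstoDistr (fun σ => conv delta (D.net σ) * conv delta (D.net σ)) (𝓝[>] 0) delta := by
  have h₀ : Tendsto (fun σ => ∫ x, D.net σ x * D.net σ x) (𝓝[>] 0) (𝓝 1) :=
    tendsto_const_nhds.congr' <|
      eventually_mem_nhdsWithin.mono fun _ hσ => (D.integral_net_sq hσ).symm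
  have h₁ : Tendsto (fun σ => ∫ x : ℝ, D.net σ x * D.net σ x * x) (𝓝[>] 0) (𝓝 0) := by
    refine tendsto_const_nhds.congr' (eventually_mem_nhdsWithin.mono fun σ hσ => ?_)
    refine (integral_eq_zero_of_odd fun x => ?_).symm
    rw [D.net_even hσ, Complex.ofReal_neg, mul_neg]
  have h₂ : Tendsto (fun σ => ∫ x, |x| ^ 2 * ‖conv (pd theta) (D.net σ) x * D.net σ x‖)
      (𝓝[>] 0) (𝓝 0) :=
    D.tendsto_integral_sq_mul_norm_conv_pd locallyIntegrable_thetaFun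
  simp only [pd_theta, conv_delta] at h₂ ⊢
  have hu : (1 : ℂ) • delta - (0 : ℂ) • pd delta = delta := by
    rw [(zero_smul ℂ (pd delta) : (0 : ℂ) • pd delta = 0), one_smul, sub_zero]
  exact hu ▸ TendstoDistr.of_moments (fun σ => (D.net σ).contDiff.mul (D.net σ).contDiff)
    (fun σ => (D.net σ).hasCompactSupport.mul_left) h₀ h₁ h₂

theorem tendstoDistr_conv_mul_delta_of_odd {f : ℝ → ℂ} (hf : LocallyIntegrable f) (ho : f.Odd) :
    TendstoDistr (fun σ => conv (ofFun f) (D.net σ) * conv delta (D.net σ)) (𝓝[>] 0) 0 := by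
  have hm {m : ℕ} (hm : 0 < m) :
      Tendsto (fun σ => ∫ x, |x| ^ m * ‖conv (ofFun f) (D.net σ) x * D.net σ x‖)
        (𝓝[>] 0) (𝓝 0) := by
    simpa only [Function.iterate_zero, id] using D.tendsto_integral_abs_pow_mul_norm_conv hf hm
  have h₀ (σ : ℝ) : ∫ x, conv (ofFun f) (D.net σ) x * D.net σ x = 0 :=
    integral_conv_mul_self_of_odd hf ho (D.net σ)
  have h₁ : Tendsto (fun σ => ∫ x : ℝ, conv (ofFun f) (D.net σ) x * D.net σ x * x)
      (𝓝[>] 0) (𝓝 0) := by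
    refine squeeze_zero_norm (fun σ => (norm_integral_le_integral_norm _).trans_eq ?_)
      (hm one_pos)
    simp [mul_comm]
  simp only [conv_delta]
  have hu : (0 : ℂ) • delta - (0 : ℂ) • pd delta = 0 := by
    rw [(zero_smul ℂ delta : (0 : ℂ) • delta = 0),
      (zero_smul ℂ (pd delta) : (0 : ℂ) • pd delta = 0), sub_zero]
  exact hu ▸ TendstoDistr.of_moments
    (fun σ => (contDiff_conv (ofFun f) _).mul (D.net σ).contDiff)
    (fun σ => (D.net σ).hasCompactSupport.mul_left)
    (tendsto_const_nhds.congr fun σ => (h₀ σ).symm) h₁ (hm two_pos)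

theorem tendstoDistr_conv_pd_lnAbs_mul_delta :
    TendstoDistr (fun σ => conv (pd lnAbs) (D.net σ) * conv delta (D.net σ)) (𝓝[>] 0)
      (-((1 / 2 : ℂ) • pd delta)) := by
  have h₀ (σ : ℝ) : ∫ x, conv (pd lnAbs) (D.net σ) x * D.net σ x = 0 :=
    integral_conv_pd_mul_self_of_even locallyIntegrable_log (fun x => by simp) (D.net σ)
  have h₁ : Tendsto (fun σ => ∫ x : ℝ, conv (pd lnAbs) (D.net σ) x * D.net σ x * x)
      (𝓝[>] 0) (𝓝 (1 / 2)) :=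
    tendsto_const_nhds.congr' (eventually_mem_nhdsWithin.mono fun _ hσ =>
      (integral_conv_pd_lnAbs_mul_self_mul_id (D.integral_net hσ)).symm)
  simp only [conv_delta]
  have hu : (0 : ℂ) • delta - (1 / 2 : ℂ) • pd delta = -((1 / 2 : ℂ) • pd delta) := by
    rw [(zero_smul ℂ delta : (0 : ℂ) • delta = 0), zero_sub]
  exact hu ▸ TendstoDistr.of_moments
    (fun σ => (contDiff_conv (pd lnAbs) _).mul (D.net σ).contDiff)
    (fun σ => (D.net σ).hasCompactSupport.mul_left)
    (tendsto_const_nhds.congr fun σ => (h₀ σ).symm) h₁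
    (D.tendsto_integral_sq_mul_norm_conv_pd locallyIntegrable_log)

end DeltaFamily

theorem norm_thetaFun_le_one (x : ℝ) : ‖thetaFun x‖ ≤ 1 := by
  rw [thetaFun]
  split_ifs <;> simp

theorem continuousAt_thetaFun {x : ℝ} (hx : x ≠ 0) : ContinuousAt thetaFun x := by
  rcases hx.lt_or_gt with hx | hx
  · exact continuousAt_const.congr <|
      (eventually_lt_nhds hx).mono fun _ hy => (if_neg hy.not_gt).symm
  · exact continuousAt_const.congr <| (eventually_gt_nhds hx).mono fun _ hy => (if_pos hy).symm

theorem thetaFun_mul_thetaFun : thetaFun * thetaFun = thetaFun := by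
  ext x
  simp [thetaFun]

theorem lnPlusFun_mul_thetaFun : lnPlusFun * thetaFun = lnPlusFun := by
  ext x
  by_cases hx : 0 < x <;> simp [lnPlusFun, thetaFun, hx]

theorem lnPlusFun_sub_lnMinusFun_mul_thetaFun :
    (lnPlusFun - lnMinusFun) * thetaFun = lnPlusFun := by
  ext x
  by_cases hx : 0 < x <;> simp [lnPlusFun, lnMinusFun, thetaFun, hx, not_lt_of_gt]

theorem lnPlusFun_sub_lnMinusFun_odd : (lnPlusFun - lnMinusFun).Odd := fun x => by
  simp [lnPlusFun, lnMinusFun]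

theorem locallyIntegrable_lnPlusFun_sub_lnMinusFun :
    LocallyIntegrable (lnPlusFun - lnMinusFun) :=
  locallyIntegrable_lnPlusFun.sub locallyIntegrable_lnMinusFun

theorem IsDeltaNet.tendstoDistr_conv_mul_conv_theta {ι : Type*} {F : Filter ι}
    [F.IsCountablyGenerated] {d : ι → Test} (hd : IsDeltaNet d F) {f : ℝ → ℂ}
    (hf : LocallyIntegrable f) :
    TendstoDistr (fun i => conv (ofFun f) (d i) * conv theta (d i)) F (ofFun (f * thetaFun)) :=
  hd.tendstoDistr_conv_mul_conv hf locallyIntegrable_thetaFun norm_thetaFun_le_one <|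
    (Measure.ae_ne volume 0).mono fun _ => continuousAt_thetaFun

theorem associatedWith_mk_of_tendstoDistr (f : moderate) {g : ℝ → ℝ → ℂ}
    (hg : ∀ φ : A0, f.1 φ = g (size φ.1)) {u : Distr} (h : TendstoDistr g (𝓝[>] 0) u) :
    AssociatedWith (Ideal.Quotient.mk nullIdeal f) u := by
  refine ⟨f, rfl, fun ψ => ⟨0, fun φ _ => ?_⟩⟩
  have hsize : Tendsto (fun ε => size φ.1 * ε) (𝓝[>] 0) (𝓝[>] 0) :=
    tendsto_nhdsWithin_iff.mpr ⟨tendsto_const_mul_nhdsGT_zero _,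
      eventually_mem_nhdsWithin.mono fun _ hε => mul_pos (size_pos φ) hε⟩
  refine ((h.tendsto ψ).comp hsize).congr' ?_
  filter_upwards [self_mem_nhdsWithin] with ε (hε : 0 < ε)
  rw [Function.comp_apply, hg, scale, dif_pos hε, size_dilate hε, mul_comm]

namespace DeltaFamily

variable (D : DeltaFamily)

theorem tendstoDistr_theta_sq :
    TendstoDistr (fun σ => conv theta (D.net σ) * conv theta (D.net σ)) (𝓝[>] 0) theta := by
  have h := D.isDeltaNet_net.tendstoDistr_conv_mul_conv_theta locallyIntegrable_thetaFun
  rwa [thetaFun_mul_thetaFun] at h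

theorem tendstoDistr_lnPlus_mul_theta :
    TendstoDistr (fun σ => conv lnPlus (D.net σ) * conv theta (D.net σ)) (𝓝[>] 0) lnPlus := by
  have h := D.isDeltaNet_net.tendstoDistr_conv_mul_conv_theta locallyIntegrable_lnPlusFun
  rwa [lnPlusFun_mul_thetaFun] at h

theorem tendstoDistr_lnAbsSgn_mul_theta :
    TendstoDistr (fun σ => conv lnAbsSgn (D.net σ) * conv theta (D.net σ)) (𝓝[>] 0) lnPlus := by
  have h := D.isDeltaNet_net.tendstoDistr_conv_mul_conv_theta
    locallyIntegrable_lnPlusFun_sub_lnMinusFun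
  rwa [lnPlusFun_sub_lnMinusFun_mul_thetaFun, ← lnAbsSgn_eq_ofFun] at h

theorem tendstoDistr_lnAbsSgn_mul_delta :
    TendstoDistr (fun σ => conv lnAbsSgn (D.net σ) * conv delta (D.net σ)) (𝓝[>] 0) 0 := by
  rw [lnAbsSgn_eq_ofFun]
  exact D.tendstoDistr_conv_mul_delta_of_odd locallyIntegrable_lnPlusFun_sub_lnMinusFun
    lnPlusFun_sub_lnMinusFun_odd

theorem tendstoDistr_xNegSuccSgn_product :
    TendstoDistr (fun σ => conv (xNegSuccSgn 1) (D.net σ) * conv theta (D.net σ) +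
      conv lnAbsSgn (D.net σ) * conv (pd delta) (D.net σ)) (𝓝[>] 0)
      (xPlusNegSucc 1 + (2 : ℂ) • delta) := by
  have h := (((D.tendstoDistr_delta_sq.const_smul 2).add
    (D.tendstoDistr_lnAbsSgn_mul_delta.deriv.const_smul 2)).sub
    D.tendstoDistr_lnAbsSgn_mul_theta.deriv.deriv).sub D.tendstoDistr_theta_sq.deriv.deriv
  simp only [← conv_xNegSuccSgn_mul_theta_add] at h
  convert h using 1
  rw [xPlusNegSucc_one, pd_theta]
  ext ψ
  change -pd (pd lnPlus) ψ - pd delta ψ + 2 * delta ψ =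
    2 * delta ψ + 2 * -0 - pd (pd lnPlus) ψ - pd delta ψ
  ring

theorem tendstoDistr_xPlusNegSucc_product :
    TendstoDistr (fun σ => conv (xPlusNegSucc 1) (D.net σ) * conv theta (D.net σ) -
      conv lnMinus (D.net σ) * conv (pd delta) (D.net σ)) (𝓝[>] 0)
      (xPlusNegSucc 1 + delta) := by
  have h := (((D.tendstoDistr_delta_sq.add D.tendstoDistr_conv_pd_lnAbs_mul_delta).add
    D.tendstoDistr_lnAbsSgn_mul_delta.deriv).sub D.tendstoDistr_lnPlus_mul_theta.deriv.deriv).sub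
    (D.tendstoDistr_theta_sq.deriv.deriv.const_smul (1 / 2))
  simp only [← conv_xPlusNegSucc_mul_theta_sub] at h
  convert h using 1
  rw [xPlusNegSucc_one, pd_theta]
  ext ψ
  change -pd (pd lnPlus) ψ - pd delta ψ + delta ψ =
    delta ψ + -(1 / 2 * pd delta ψ) + -0 - pd (pd lnPlus) ψ - 1 / 2 * pd delta ψ
  ring

theorem associatedWith_xNegSuccSgn_product :
    AssociatedWith
      (D.model (xNegSuccSgn 1) * D.model theta + D.model lnAbsSgn * D.model (pd delta))
      (xPlusNegSucc 1 + (2 : ℂ) • delta) :=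
  let R (u : Distr) : moderate := ⟨D.rep u, D.isModerate_rep u⟩
  associatedWith_mk_of_tendstoDistr (R (xNegSuccSgn 1) * R theta + R lnAbsSgn * R (pd delta))
    (fun _ => rfl) D.tendstoDistr_xNegSuccSgn_product

theorem associatedWith_xPlusNegSucc_product :
    AssociatedWith
      (D.model (xPlusNegSucc 1) * D.model theta - D.model lnMinus * D.model (pd delta))
      (xPlusNegSucc 1 + delta) :=
  let R (u : Distr) : moderate := ⟨D.rep u, D.isModerate_rep u⟩
  associatedWith_mk_of_tendstoDistr (R (xPlusNegSucc 1) * R theta - R lnMinus * R (pd delta))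
    (fun _ => rfl) D.tendstoDistr_xPlusNegSucc_product

end DeltaFamily

end Colombeau

end

theorem corollary1 (D : Colombeau.DeltaFamily) :
    Colombeau.AssociatedWith
      (D.model (Colombeau.xNegSuccSgn 1) * D.model Colombeau.theta +
        D.model Colombeau.lnAbsSgn * D.model (Colombeau.pd Colombeau.delta))
      (Colombeau.xPlusNegSucc 1 + (2 : ℂ) • Colombeau.delta) ∧
    Colombeau.AssociatedWith
      (D.model (Colombeau.xPlusNegSucc 1) * D.model Colombeau.theta -
        D.model Colombeau.lnMinus * D.model (Colombeau.pd Colombeau.delta))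
      (Colombeau.xPlusNegSucc 1 + Colombeau.delta) :=
  ⟨D.associatedWith_xNegSuccSgn_product, D.associatedWith_xPlusNegSucc_product⟩
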